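/- **Setting.** Let $r_0>0$, $E>0$, $\chi_\perp,\chi_\parallel\in\mathbb C$, and let $\ell\ge 2$ and $n$ be integers with $n>\ell$ and $n\neq 2\ell$. Let $\Omega=\{|x|<r_0\}\subset\mathbb R^2$, with outward normal $\nu$ and counterclockwise tangent $T$; in polar coordinates $\partial_\nu=\partial_r$ and $\partial_T=r^{-1}\partial_\theta$. Let $H=-E\,r^\ell\cos(\ell\theta)$, $f(\theta)=r_0\cos(n\theta)$ and $f'=\partial_Tf$, so that the perturbed boundary is $r=r_0+\epsilon f(\theta)$. The permittivities $\varepsilon_\omega,\varepsilon_{2\omega}\in\mathbb C$ are different from $-1$ (the resonant value). The subscripts $|_\pm$ denote traces on $\partial\Omega$ from outside and inside. The leading-order fields $u_\omega^{(0)},u_{2\omega}^{(0)}$ and the first-order fields $u_\omega^{(1)},u_{2\omega}^{(1)}$ are the potentials that are harmonic off $\partial\Omega$, $C^2$ up to $\partial\Omega$ from each side, and satisfy on $\partial\Omega$ $$u^{(0)}_\omega|_+=u^{(0)}_\omega|_-,\quad \partial_\nu u^{(0)}_\omega|_+=\varepsilon_\omega\partial_\nu u^{(0)}_\omega|_-,\quad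 u_{2\omega}^{(0)}|_+-u_{2\omega}^{(0)}|_-=4\pi P_\perp^{(0)},\quad \partial_\nu u_{2\omega}^{(0)}|_+-\varepsilon_{2\omega}\partial_\nu u_{2\omega}^{(0)}|_-=-4\pi\sigma^{(0)},$$ $$u_\omega^{(1)}|_+-u_\omega^{(1)}|_-=J[u_\omega^{(0)}],\qquad \partial_\nu u_\omega^{(1)}|_+-\varepsilon_\omega\partial_\nu u_\omega^{(1)}|_-=K_{\varepsilon_\omega}[u_\omega^{(0)}],$$ $$u_{2\omega}^{(1)}|_+-u_{2\omega}^{(1)}|_-=J[u_{2\omega}^{(0)}]+4\pi P_\perp^{(1)},\qquad \partial_\nu u_{2\omega}^{(1)}|_+-\varepsilon_{2\omega}\partial_\nu u_{2\omega}^{(1)}|_-=K_{\varepsilon_{2\omega}}[u_{2\omega}^{(0)}]-4\pi\sigma^{(1)},$$ and, as $|x|\to\infty$, $u_\omega^{(0)}=H+O(|x|^{-1})$, $u_{2\omega}^{(0)}=O(|x|^{-2})$, $u_\omega^{(1)}=O(|x|^{-1})$, $u_{2\omega}^{(1)}=o(1)$. Here $$J[w]=f(\partial_\nu w|_--\partial_\nu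 w|_+),\qquad K_\varepsilon[w]=f(\varepsilon\,\partial_\nu^2w|_--\partial^2_\nu w|_+)+f'(\partial_Tw|_+-\varepsilon\,\partial_Tw|_-),$$ and, with all fields taken from the inside and $u_j=u^{(j)}_\omega$, $N_1=\partial_\nu u_1+f\partial_\nu^2u_0-f'\partial_Tu_0$ and $T_1=\partial_Tu_1+f\,\partial_\nu(\partial_Tu_0)+f'\partial_\nu u_0$, $$P_\perp^{(0)}=\chi_\perp(\varepsilon_\omega\partial_\nu u_0)^2,\quad P_\parallel^{(0)}=2\chi_\parallel\varepsilon_\omega\,\partial_\nu u_0\,\partial_Tu_0,\quad P_\perp^{(1)}=2\chi_\perp\varepsilon_\omega^2\,\partial_\nu u_0\,N_1,\quad P_\parallel^{(1)}=2\chi_\parallel\varepsilon_\omega(\partial_\nu u_0\,T_1+\partial_Tu_0\,N_1),$$ $$\sigma^{(0)}=-\tfrac1{r_0}\tfrac{d}{d\theta}P_\parallel^{(0)},\qquad \sigma^{(1)}=\tfrac{f}{r_0^2}\tfrac{d}{d\theta}P_\parallel^{(0)}-\tfrac1{r_0}\tfrac{d}{d\theta}P_\parallel^{(1)}.$$ A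 field that is harmonic outside some circle is called $2^m$-multipole radiation if it is $O(|x|^{-m})$ as $|x|\to\infty$, uniformly in all directions; it is called dipole radiation if it is $O(|x|^{-1})$. **Theorem.** For $\varepsilon_\omega,\varepsilon_{2\omega}\neq-1$ these systems have a solution, and every solution satisfies, for $r>r_0$, $$u_{2\omega}^{(1)}=M_{|n-2\ell|}\frac{\cos((n-2\ell)\theta)}{r^{|n-2\ell|}}+M_n\frac{\cos(n\theta)}{r^n}+M_{n+2\ell}\frac{\cos((n+2\ell)\theta)}{r^{n+2\ell}}.$$ With $A=\dfrac{8\pi E^2\ell^2r_0^{2\ell-2}}{(1+\varepsilon_{2\omega})(1+\varepsilon_\omega)^2}$, $X=\chi_\perp\varepsilon_\omega^2\varepsilon_{2\omega}$ and $Y=\chi_\parallel\varepsilon_\omega$, the coefficients are $$M_{|n-2\ell|}=A\,r_0^{n-2\ell}\Big(\ell\tfrac{\varepsilon_{2\omega}-3}{1+\varepsilon_{2\omega}}X+\tfrac{(n-\ell-1)\varepsilon_\omega-(3n-3\ell+1)}{1+\varepsilon_\omega}X+2\tfrac{(n-2\ell+1)+(n+2\ell+1)\varepsilon_{2\omega}}{1+\varepsilon_{2\omega}}Y\Big)\quad(n>2\ell),$$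 $$M_{|n-2\ell|}=A\,r_0^{2\ell-n}\Big(\ell X+\tfrac{(n-\ell-1)\varepsilon_\omega-(3n-3\ell+1)}{1+\varepsilon_\omega}X-2(n-2\ell+1)Y\Big)\quad(n<2\ell),$$ $$M_n=2A\,r_0^n\Big((\ell-1)X-\tfrac{1-\varepsilon_\omega}{1+\varepsilon_\omega}(n-\ell)(X+2Y)\Big),\qquad M_{n+2\ell}=A\,r_0^{n+2\ell}(n+2\ell-1)(X+2Y).$$ *Radiation.* If the relative symmetry degree $d_{\rm rel}=|n-2\ell|$ equals $1$, then $u_{2\omega}^{(1)}$ is dipole radiation. If $d_{\rm rel}=m$, then $u_{2\omega}^{(1)}$ is $2^m$-multipole radiation, and it is $o(|x|^{-m})$ if and only if $M_{|n-2\ell|}=0$. If $\chi_\perp\ne0$ and $\varepsilon_{2\omega}\notin\{0,-1\}$, then $M_{|n-2\ell|}\neq0$ for all but finitely many $\varepsilon_\omega$. *Resonance.* The bounds on $u_{2\omega}^{(1)}$ below hold uniformly in $|x|>r_0$. * For fixed $\varepsilon_{2\omega}\ne-1$, $u_{2\omega}^{(1)}=O((1+\varepsilon_\omega)^{-3})$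 as $\varepsilon_\omega\to-1$. If $\chi_\perp\varepsilon_{2\omega}\neq0$, then $M_{|n-2\ell|}$ has exactly this order. * For fixed $\varepsilon_\omega\neq-1$, $u_{2\omega}^{(1)}=O((1+\varepsilon_{2\omega})^{-2})$ as $\varepsilon_{2\omega}\to-1$. If $n>2\ell$, $\varepsilon_\omega\ne0$ and $\chi_\perp\varepsilon_\omega\neq2\chi_\parallel$, then $M_{|n-2\ell|}$ has exactly this order. * As $\varepsilon_\omega\to-1$ and $\varepsilon_{2\omega}\to-1$ together, $u_{2\omega}^{(1)}=O((1+\varepsilon_\omega)^{-2}(1+\varepsilon_{2\omega})^{-2})$ in the regime $|1+\varepsilon_{2\omega}|\le|1+\varepsilon_\omega|$, and $u_{2\omega}^{(1)}=O((1+\varepsilon_\omega)^{-3}(1+\varepsilon_{2\omega})^{-1})$ in the regime $|1+\varepsilon_\omega|\le|1+\varepsilon_{2\omega}|$. The first order is exact for $M_{|n-2\ell|}$ when $(1+\varepsilon_{2\omega})/(1+\varepsilon_\omega)\to0$, if $n>2\ell$ and $\chi_\perp+2\chi_\parallel\ne0$. The second is exact when $(1+\varepsilon_\omega)/(1+\varepsilon_{2\omega})\to0$,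 if $\chi_\perp\ne0$. -/

import Mathlib

open Filter Asymptotics Topology

noncomputable section

namespace SecondHarmonic

/-- The optical constants of the wire: the permittivities at the fundamental and at the doubled
frequency, and the two surface susceptibilities. -/
structure Medium where
  /-- permittivity at frequency `ω` -/
  epsω : ℂ
  /-- permittivity at frequency `2ω` -/
  eps2ω : ℂ
  /-- normal surface susceptibility -/
  χperp : ℂ
  /-- tangential surface susceptibility -/
  χpar : ℂ

/-- A potential that may jump across the circle `|x| = r₀`. The plane is identified with `ℂ`;
`inn` is the potential on `|x| ≤ r₀` and `out` the potential on `|x| ≥ r₀` (their values elsewhere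
play no role), so that on the circle `inn` and `out` are the two one-sided traces. -/
structure Potential where
  /-- the potential inside -/
  inn : ℂ → ℂ
  /-- the potential outside -/
  out : ℂ → ℂ

/-- Classical solution of the Laplace equation off the circle `|x| = r₀`, of class `C²` up to the
circle from either side. -/
structure Potential.IsHarmonic (r₀ : ℝ) (u : Potential) : Prop where
  contDiff_inn : ContDiffOn ℝ 2 u.inn (Metric.closedBall 0 r₀)
  contDiff_out : ContDiffOn ℝ 2 u.out (Metric.ball 0 r₀)ᶜ
  harmonic_inn : InnerProductSpace.HarmonicOnNhd u.inn (Metric.ball 0 r₀)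
  harmonic_out : InnerProductSpace.HarmonicOnNhd u.out (Metric.closedBall 0 r₀)ᶜ

/-! ### Derivatives on the circle

In polar coordinates `x = r e^{iθ}` (`circleMap 0 r θ`) one has `∂/∂ν = ∂/∂r` and
`∂/∂T = r⁻¹ ∂/∂θ`. The suffixes `Inn` and `Out` stand for the one-sided values `|₋` and `|₊`. -/

/-- The tangential derivative `∂v/∂T` at the point `r e^{iθ}` of the circle of radius `r`. -/
def dT (v : ℂ → ℂ) (r θ : ℝ) : ℂ := (r : ℂ)⁻¹ * deriv (fun φ : ℝ => v (circleMap 0 r φ)) θ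

/-- `∂u/∂ν|₋` at `r₀ e^{iθ}`. -/
def dνInn (u : Potential) (r₀ θ : ℝ) : ℂ :=
  derivWithin (fun r : ℝ => u.inn (circleMap 0 r θ)) (Set.Icc 0 r₀) r₀

/-- `∂u/∂ν|₊` at `r₀ e^{iθ}`. -/
def dνOut (u : Potential) (r₀ θ : ℝ) : ℂ :=
  derivWithin (fun r : ℝ => u.out (circleMap 0 r θ)) (Set.Ici r₀) r₀

/-- `∂²u/∂ν²|₋` at `r₀ e^{iθ}`. -/
def dννInn (u : Potential) (r₀ θ : ℝ) : ℂ :=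
  iteratedDerivWithin 2 (fun r : ℝ => u.inn (circleMap 0 r θ)) (Set.Icc 0 r₀) r₀

/-- `∂²u/∂ν²|₊` at `r₀ e^{iθ}`. -/
def dννOut (u : Potential) (r₀ θ : ℝ) : ℂ :=
  iteratedDerivWithin 2 (fun r : ℝ => u.out (circleMap 0 r θ)) (Set.Ici r₀) r₀

/-- `∂/∂ν (∂u/∂T)|₋` at `r₀ e^{iθ}`. -/
def dνTInn (u : Potential) (r₀ θ : ℝ) : ℂ :=
  derivWithin (fun r : ℝ => dT u.inn r θ) (Set.Icc 0 r₀) r₀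

/-- The tangential derivative `f' = ∂f/∂T` on the circle of a function `f` of the angle. -/
def fT (r₀ : ℝ) (f : ℝ → ℝ) (θ : ℝ) : ℂ := ((r₀⁻¹ * deriv f θ : ℝ) : ℂ)

/-! ### Nonlinear surface sources of orders zero and one in the boundary perturbation -/

/-- `P_⊥^{s,(0)} = χ_⊥ (ε_ω ∂u₀/∂ν|₋)²`. -/
def Pperp0 (μ : Medium) (r₀ : ℝ) (u₀ : Potential) (θ : ℝ) : ℂ :=
  μ.χperp * (μ.epsω * dνInn u₀ r₀ θ) ^ 2

/-- `P_∥^{s,(0)} = 2 χ_∥ (ε_ω ∂u₀/∂ν|₋) (∂u₀/∂T|₋)`. -/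
def Ppar0 (μ : Medium) (r₀ : ℝ) (u₀ : Potential) (θ : ℝ) : ℂ :=
  2 * μ.χpar * (μ.epsω * dνInn u₀ r₀ θ) * dT u₀.inn r₀ θ

/-- `σ^{s,(0)} = - (1/h) dP_∥^{s,(0)}/dθ`, with the Lamé coefficient `h = r₀` of the circle. -/
def sigma0 (μ : Medium) (r₀ : ℝ) (u₀ : Potential) (θ : ℝ) : ℂ :=
  -((r₀ : ℂ)⁻¹ * deriv (Ppar0 μ r₀ u₀) θ)

/-- First-order term of the interior normal derivative of `u₀ + ε u₁` on the perturbed curve: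
`∂u₁/∂ν + f ∂²u₀/∂ν² - f' ∂u₀/∂T`. -/
def normal1 (r₀ : ℝ) (f : ℝ → ℝ) (u₀ u₁ : Potential) (θ : ℝ) : ℂ :=
  dνInn u₁ r₀ θ + f θ * dννInn u₀ r₀ θ - fT r₀ f θ * dT u₀.inn r₀ θ

/-- First-order term of the interior tangential derivative of `u₀ + ε u₁` on the perturbed curve:
`∂u₁/∂T + f ∂/∂ν(∂u₀/∂T) + f' ∂u₀/∂ν`. -/
def tangential1 (r₀ : ℝ) (f : ℝ → ℝ) (u₀ u₁ : Potential) (θ : ℝ) : ℂ :=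
  dT u₁.inn r₀ θ + f θ * dνTInn u₀ r₀ θ + fT r₀ f θ * dνInn u₀ r₀ θ

/-- `P_⊥^{s,(1)}`. -/
def Pperp1 (μ : Medium) (r₀ : ℝ) (f : ℝ → ℝ) (u₀ u₁ : Potential) (θ : ℝ) : ℂ :=
  2 * μ.χperp * μ.epsω ^ 2 * dνInn u₀ r₀ θ * normal1 r₀ f u₀ u₁ θ

/-- `P_∥^{s,(1)}`. -/
def Ppar1 (μ : Medium) (r₀ : ℝ) (f : ℝ → ℝ) (u₀ u₁ : Potential) (θ : ℝ) : ℂ :=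
  2 * μ.χpar * μ.epsω * dνInn u₀ r₀ θ * tangential1 r₀ f u₀ u₁ θ
    + 2 * μ.χpar * μ.epsω * dT u₀.inn r₀ θ * normal1 r₀ f u₀ u₁ θ

/-- `σ^{s,(1)} = (κ f / h) dP_∥^{s,(0)}/dθ - (1/h) dP_∥^{s,(1)}/dθ` with `h = r₀` and the curvature
`κ = 1/r₀`: the Lamé coefficient of the perturbed curve is `h (1 + ε κ f) + O(ε²)`. -/
def sigma1 (μ : Medium) (r₀ : ℝ) (f : ℝ → ℝ) (u₀ u₁ : Potential) (θ : ℝ) : ℂ :=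
  ((r₀ : ℂ)⁻¹ * f θ) * (r₀ : ℂ)⁻¹ * deriv (Ppar0 μ r₀ u₀) θ
    - (r₀ : ℂ)⁻¹ * deriv (Ppar1 μ r₀ f u₀ u₁) θ

/-! ### The leading-order and the first-order coupled systems -/

/-- `f (∂w/∂ν|₋ - ∂w/∂ν|₊)`. -/
def jump1 (r₀ : ℝ) (f : ℝ → ℝ) (w : Potential) (θ : ℝ) : ℂ :=
  f θ * (dνInn w r₀ θ - dνOut w r₀ θ)

/-- `f (ε ∂²w/∂ν²|₋ - ∂²w/∂ν²|₊) + f' (∂w/∂T|₊ - ε ∂w/∂T|₋)`. -/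
def fluxJump1 (eps : ℂ) (r₀ : ℝ) (f : ℝ → ℝ) (w : Potential) (θ : ℝ) : ℂ :=
  f θ * (eps * dννInn w r₀ θ - dννOut w r₀ θ)
    + fT r₀ f θ * (dT w.out r₀ θ - eps * dT w.inn r₀ θ)

/-- The leading-order coupled system on the disk `|x| < r₀` with background potential `H`, for the
linear potential `u₀` and the second-harmonic potential `v₀`. -/
structure IsLeadingOrder (μ : Medium) (r₀ : ℝ) (H : ℂ → ℂ) (u₀ v₀ : Potential) : Prop where
  harmonic_u : u₀.IsHarmonic r₀
  trace_u : ∀ θ : ℝ, u₀.out (circleMap 0 r₀ θ) = u₀.inn (circleMap 0 r₀ θ)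
  flux_u : ∀ θ : ℝ, dνOut u₀ r₀ θ = μ.epsω * dνInn u₀ r₀ θ
  decay_u : (fun x => u₀.out x - H x) =O[Bornology.cobounded ℂ] fun x => ‖x‖⁻¹
  harmonic_v : v₀.IsHarmonic r₀
  trace_v : ∀ θ : ℝ, v₀.out (circleMap 0 r₀ θ) - v₀.inn (circleMap 0 r₀ θ)
    = 4 * Real.pi * Pperp0 μ r₀ u₀ θ
  flux_v : ∀ θ : ℝ, dνOut v₀ r₀ θ - μ.eps2ω * dνInn v₀ r₀ θ
    = -4 * Real.pi * sigma0 μ r₀ u₀ θ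
  decay_v : v₀.out =O[Bornology.cobounded ℂ] fun x => (‖x‖ ^ 2)⁻¹

/-- The first-order coupled system, for the perturbation `{x + ε f(x) ν(x)}` of the circle
`|x| = r₀`, of the first-order terms `u₁`, `v₁` of the linear and the second-harmonic potential. -/
structure IsFirstOrder (μ : Medium) (r₀ : ℝ) (f : ℝ → ℝ) (u₀ v₀ u₁ v₁ : Potential) : Prop where
  harmonic_u : u₁.IsHarmonic r₀
  trace_u : ∀ θ : ℝ, u₁.out (circleMap 0 r₀ θ) - u₁.inn (circleMap 0 r₀ θ) = jump1 r₀ f u₀ θ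
  flux_u : ∀ θ : ℝ, dνOut u₁ r₀ θ - μ.epsω * dνInn u₁ r₀ θ = fluxJump1 μ.epsω r₀ f u₀ θ
  decay_u : u₁.out =O[Bornology.cobounded ℂ] fun x => ‖x‖⁻¹
  harmonic_v : v₁.IsHarmonic r₀
  trace_v : ∀ θ : ℝ, v₁.out (circleMap 0 r₀ θ) - v₁.inn (circleMap 0 r₀ θ)
    = jump1 r₀ f v₀ θ + 4 * Real.pi * Pperp1 μ r₀ f u₀ u₁ θ
  flux_v : ∀ θ : ℝ, dνOut v₁ r₀ θ - μ.eps2ω * dνInn v₁ r₀ θ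
    = fluxJump1 μ.eps2ω r₀ f v₀ θ - 4 * Real.pi * sigma1 μ r₀ f u₀ u₁ θ
  decay_v : Tendsto v₁.out (Bornology.cobounded ℂ) (𝓝 0)

/-- The background potential `H = -E r^ℓ cos(ℓθ)`. -/
def background (E : ℝ) (ℓ : ℕ) (x : ℂ) : ℂ :=
  ((-E * ‖x‖ ^ ℓ * Real.cos (ℓ * x.arg) : ℝ) : ℂ)

/-- The boundary perturbation `f(θ) = r₀ cos(nθ)`. -/
def perturbation (r₀ : ℝ) (n : ℕ) (θ : ℝ) : ℝ := r₀ * Real.cos (n * θ)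

/-- `u₀, v₀` are the leading-order and `u₁, v₁` the first-order linear and second-harmonic
potentials for the background `-E r^ℓ cos(ℓθ)` and the perturbation `r₀ cos(nθ)` of the disk. -/
def IsExpansion (μ : Medium) (E r₀ : ℝ) (ℓ n : ℕ) (u₀ v₀ u₁ v₁ : Potential) : Prop :=
  IsLeadingOrder μ r₀ (background E ℓ) u₀ v₀ ∧ IsFirstOrder μ r₀ (perturbation r₀ n) u₀ v₀ u₁ v₁

/-! ### Radiation -/

/-- The relative symmetry degree `|n - 2ℓ|`. -/
def relDegree (ℓ n : ℕ) : ℕ := ((n : ℤ) - 2 * ℓ).natAbs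

/-- `2^m`-multipole radiation: a solution of the Laplace equation outside some circle that is
`O(|x|^{-m})` at infinity, uniformly in all directions. -/
def IsMultipoleRadiation (m : ℕ) (v : ℂ → ℂ) : Prop :=
  (∃ R : ℝ, InnerProductSpace.HarmonicOnNhd v (Metric.closedBall 0 R)ᶜ) ∧
    v =O[Bornology.cobounded ℂ] fun x => (‖x‖ ^ m)⁻¹

/-- Dipole radiation: a solution of the Laplace equation outside some circle that is `O(1/|x|)` at
infinity, uniformly in all directions. -/
def IsDipoleRadiation (v : ℂ → ℂ) : Prop :=
  (∃ R : ℝ, InnerProductSpace.HarmonicOnNhd v (Metric.closedBall 0 R)ᶜ) ∧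
    v =O[Bornology.cobounded ℂ] fun x => ‖x‖⁻¹

/-- The common factor `8π E² ℓ² r₀^{2ℓ-2} / ((1+ε_{2ω}) (1+ε_ω)²)`. -/
def prefactor (μ : Medium) (E r₀ : ℝ) (ℓ : ℕ) : ℂ :=
  8 * Real.pi * E ^ 2 * ℓ ^ 2 * r₀ ^ (2 * ℓ - 2) / ((1 + μ.eps2ω) * (1 + μ.epsω) ^ 2)

/-- The coefficient `M_{|n-2ℓ|}` of `r^{-|n-2ℓ|} cos((n-2ℓ)θ)`. -/
def coeffRel (μ : Medium) (E r₀ : ℝ) (ℓ n : ℕ) : ℂ :=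
  prefactor μ E r₀ ℓ *
    (if 2 * ℓ < n then
      ℓ * ((μ.eps2ω - 3) / (1 + μ.eps2ω)) * (μ.χperp * μ.epsω ^ 2 * μ.eps2ω)
        + ((n - ℓ - 1) * μ.epsω - (3 * n - 3 * ℓ + 1)) / (1 + μ.epsω)
          * (μ.χperp * μ.epsω ^ 2 * μ.eps2ω)
        + 2 * (((n - 2 * ℓ + 1) + (n + 2 * ℓ + 1) * μ.eps2ω) / (1 + μ.eps2ω))
          * (μ.χpar * μ.epsω)
    else
      ℓ * (μ.χperp * μ.epsω ^ 2 * μ.eps2ω)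
        + ((n - ℓ - 1) * μ.epsω - (3 * n - 3 * ℓ + 1)) / (1 + μ.epsω)
          * (μ.χperp * μ.epsω ^ 2 * μ.eps2ω)
        - 2 * (n - 2 * ℓ + 1) * (μ.χpar * μ.epsω))
    * r₀ ^ relDegree ℓ n

/-- The coefficient `M_n` of `r^{-n} cos(nθ)`. -/
def coeffMid (μ : Medium) (E r₀ : ℝ) (ℓ n : ℕ) : ℂ :=
  2 * prefactor μ E r₀ ℓ *
    ((ℓ - 1) * (μ.χperp * μ.epsω ^ 2 * μ.eps2ω)
      - (1 - μ.epsω) / (1 + μ.epsω) * (n - ℓ)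
        * (μ.χperp * μ.epsω ^ 2 * μ.eps2ω + 2 * (μ.χpar * μ.epsω)))
    * r₀ ^ n

/-- The coefficient `M_{n+2ℓ}` of `r^{-(n+2ℓ)} cos((n+2ℓ)θ)`. -/
def coeffSum (μ : Medium) (E r₀ : ℝ) (ℓ n : ℕ) : ℂ :=
  prefactor μ E r₀ ℓ * (n + 2 * ℓ - 1)
    * (μ.χperp * μ.epsω ^ 2 * μ.eps2ω + 2 * (μ.χpar * μ.epsω))
    * r₀ ^ (n + 2 * ℓ)

end SecondHarmonic

end

open SecondHarmonic

/-! Uniqueness comes from reflection in the circle. If a potential is continuous across |x| = r₀ and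
bounded at infinity, its outer part composed with x ↦ r₀²/x̄ is harmonic in the punctured disk,
bounded near 0, and equal to the inner part on the circle; hence the two coincide
(`out_inversion_eq_inn`). The two normal derivatives are therefore opposite, and a homogeneous flux
condition reads (1 + ε) ∂u/∂ν|₋ = 0. For ε ≠ -1 the inner part is constant
(`inn_eq_const_of_neumann`), the outer part is the same constant, and decay makes it zero
(`eq_zero_of_transmission`). Applied to u₀, v₀, u₁, v₁ in this order, this determines v₁
(`IsExpansion.agree`), so it suffices to compute one solution.

All sources are trigonometric polynomials: the modes are 0 and 2ℓ for v₀, n ± ℓ for u₁, and n, n ±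
2ℓ for v₁. Each nonzero mode is solved separately by `outAmplitude`, at the cost of one factor 1/(1
+ ε).

The orders at resonance come from counting these factors. The field u₀ carries 1/(1 + ε_ω), and the
sources at 2ω are quadratic in the linear field, which gives two factors. The correction u₁ adds a
third through the reflection coefficient (1 - ε_ω)/(1 + ε_ω); inside the disk it occupies only the
mode n - ℓ, so it reaches n - 2ℓ and n but not n + 2ℓ. Solving for v₁ costs 1/(1 + ε_{2ω}); the
second such factor, inherited from v₀, survives only in the mode n - 2ℓ when n > 2ℓ. So every
coefficient is a constant times `profile` with polynomial p and q. Boundedness of p, q near the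
resonances gives the upper bounds (`exists_norm_out_le`), and their values at the resonances give
the exact orders. Since n > ℓ, the frequency |n - 2ℓ| is the smallest of the three and governs the
radiation. -/

namespace SecondHarmonic

open InnerProductSpace Metric

section

/-! ### Harmonic functions in the plane -/

theorem harmonicAt_of_re_im {f : ℂ → ℂ} {x : ℂ} (hre : HarmonicAt (fun z => (f z).re) x)
    (him : HarmonicAt (fun z => (f z).im) x) : HarmonicAt f x := by
  have h := (hre.comp_CLM Complex.ofRealCLM).add
    (him.comp_CLM (Complex.I • Complex.ofRealCLM))
  convert h using 1
  funext z
  simp [mul_comm Complex.I, Complex.re_add_im]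

theorem HarmonicAt.re {f : ℂ → ℂ} {x : ℂ} (h : HarmonicAt f x) :
    HarmonicAt (fun z => (f z).re) x := h.comp_CLM Complex.reCLM

theorem HarmonicAt.im {f : ℂ → ℂ} {x : ℂ} (h : HarmonicAt f x) :
    HarmonicAt (fun z => (f z).im) x := h.comp_CLM Complex.imCLM

/-- A real harmonic function is locally the real part of a holomorphic function. -/
theorem HarmonicAt.exists_analyticAt_re {f : ℂ → ℝ} {x : ℂ} (h : HarmonicAt f x) :
    ∃ F : ℂ → ℂ, AnalyticAt ℂ F x ∧ ∀ᶠ z in 𝓝 x, f z = (F z).re := by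
  obtain ⟨ε, hε, hb⟩ := Metric.eventually_nhds_iff_ball.1 h.eventually
  obtain ⟨F, hF, hFf⟩ := HarmonicOnNhd.exists_analyticOnNhd_ball_re_eq (f := f) (z := x) (R := ε) hb
  refine ⟨F, hF x (mem_ball_self hε), ?_⟩
  filter_upwards [ball_mem_nhds x hε] with z hz using (hFf hz).symm

theorem analyticAt_conj_conj {F : ℂ → ℂ} {x : ℂ} (hF : AnalyticAt ℂ F (starRingEnd ℂ x)) :
    AnalyticAt ℂ (fun z => starRingEnd ℂ (F (starRingEnd ℂ z))) x := by
  rw [Complex.analyticAt_iff_eventually_differentiableAt] at hF ⊢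
  filter_upwards [Complex.continuous_conj.continuousAt.eventually hF] with z hz
  have := hz.conj_conj
  simpa [Function.comp_def] using this

/-- Locally f = Re F with F holomorphic, and F(w̄) has the same real part as its conjugate, which is
a holomorphic function of w. -/
theorem HarmonicAt.comp_conj_analyticAt_real {f : ℂ → ℝ} {φ : ℂ → ℂ} {x : ℂ}
    (hφ : AnalyticAt ℂ φ x) (h : HarmonicAt f (starRingEnd ℂ (φ x))) :
    HarmonicAt (fun z => f (starRingEnd ℂ (φ z))) x := by
  obtain ⟨F, hF, hFf⟩ := HarmonicAt.exists_analyticAt_re h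
  have h1 := ((analyticAt_conj_conj hF).comp hφ).harmonicAt_re
  refine (harmonicAt_congr_nhds ?_).2 h1
  have hc : ContinuousAt (fun z => starRingEnd ℂ (φ z)) x :=
    Complex.continuous_conj.continuousAt.comp hφ.continuousAt
  filter_upwards [hc.eventually hFf] with z hz
  simp [hz]

/-- Harmonicity is preserved by composition with an antiholomorphic map. -/
theorem HarmonicAt.comp_conj_analyticAt {f : ℂ → ℂ} {φ : ℂ → ℂ} {x : ℂ}
    (hφ : AnalyticAt ℂ φ x) (h : HarmonicAt f (starRingEnd ℂ (φ x))) :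
    HarmonicAt (fun z => f (starRingEnd ℂ (φ z))) x :=
  harmonicAt_of_re_im (HarmonicAt.comp_conj_analyticAt_real hφ (HarmonicAt.re h))
    (HarmonicAt.comp_conj_analyticAt_real hφ (HarmonicAt.im h))

/-- Writing f = Re F locally gives |exp F| = exp f, so the maximum modulus principle for exp F
applies. -/
theorem HarmonicAt.eventually_eq_of_isLocalMax {f : ℂ → ℝ} {x : ℂ} (h : HarmonicAt f x)
    (hm : IsLocalMax f x) : ∀ᶠ z in 𝓝 x, f z = f x := by
  obtain ⟨F, hF, hFf⟩ := HarmonicAt.exists_analyticAt_re h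
  have h1 : ∀ᶠ z in 𝓝 x, Complex.exp (F z) = Complex.exp (F x) := by
    apply Complex.eventually_eq_of_isLocalMax_norm
    · filter_upwards [hF.eventually_analyticAt] with z hz using hz.differentiableAt.cexp
    · filter_upwards [hm, hFf] with z hz hz2
      simp only [Function.comp, Complex.norm_exp]
      rw [← hz2, ← hFf.self_of_nhds]
      exact Real.exp_le_exp.2 hz
  filter_upwards [h1, hFf] with z hz hz2
  have h2 := congrArg norm hz
  rw [Complex.norm_exp, Complex.norm_exp, Real.exp_eq_exp] at h2
  rw [hz2, h2, hFf.self_of_nhds]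

/-- The weak maximum principle. -/
theorem nonpos_of_harmonicOnNhd {U : Set ℂ} (hU : IsOpen U) (hb : Bornology.IsBounded U)
    {f : ℂ → ℝ} (hc : ContinuousOn f (closure U)) (hh : HarmonicOnNhd f U)
    (hf : ∀ x ∈ frontier U, f x ≤ 0) : ∀ x ∈ U, f x ≤ 0 := by
  intro x₀ hx₀
  by_contra! hpos
  have hK : IsCompact (closure U) := hb.isCompact_closure
  obtain ⟨a, haK, ha⟩ := hK.exists_isMaxOn ⟨x₀, subset_closure hx₀⟩ hc
  have hM : 0 < f a := hpos.trans_le (ha (subset_closure hx₀))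
  have hK' : IsCompact (closure U ∩ f ⁻¹' {f a}) :=
    hK.of_isClosed_subset (hc.preimage_isClosed_of_isClosed isClosed_closure isClosed_singleton)
      Set.inter_subset_left
  -- Among the maximizers, b has the largest real part. If b were interior, f would be constant near
  -- b, and a point slightly to the right would be a maximizer with larger real part. No
  -- connectedness of `U` is needed.
  obtain ⟨b, ⟨hbK, hbf⟩, hbmax⟩ := hK'.exists_isMaxOn ⟨a, haK, rfl⟩
    Complex.continuous_re.continuousOn
  have hbf' : f b = f a := hbf
  have hbU : b ∈ U := by
    by_contra hbU
    have := hf b ⟨hbK, fun h => hbU (interior_subset h)⟩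
    linarith
  have hmax : IsLocalMax f b := by
    filter_upwards [hU.mem_nhds hbU] with z hz
    rw [hbf']
    exact ha (subset_closure hz)
  obtain ⟨ε, hε, hball⟩ := Metric.eventually_nhds_iff_ball.1
    ((HarmonicAt.eventually_eq_of_isLocalMax (hh b hbU) hmax).and (hU.mem_nhds hbU))
  have hmem : b + ((ε / 2 : ℝ) : ℂ) ∈ ball b ε := by
    rw [mem_ball, dist_eq_norm, add_sub_cancel_left, Complex.norm_real, Real.norm_eq_abs,
      abs_of_pos (by positivity)]
    linarith
  have h1 := hball _ hmem
  have h2 := hbmax (a := b + ((ε / 2 : ℝ) : ℂ)) ⟨subset_closure h1.2, h1.1.trans hbf'⟩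
  simp only [Set.mem_ofPred_eq, Complex.add_re, Complex.ofReal_re] at h2
  linarith

theorem harmonicAt_log_norm_div {R : ℝ} (hR : 0 < R) {x : ℂ} (hx : x ≠ 0) :
    HarmonicAt (fun z : ℂ => Real.log (‖z‖ / R)) x := by
  have h : AnalyticAt ℂ (fun z : ℂ => z / (R : ℂ)) x := by fun_prop
  have h2 := h.harmonicAt_log_norm (div_ne_zero hx (by exact_mod_cast hR.ne'))
  simpa [abs_of_pos hR] using h2

/-- A harmonic function on a punctured disk that is bounded above near the puncture and
nonpositive on the boundary circle is nonpositive. -/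
theorem nonpos_of_harmonicOnNhd_punctured {R C ρ : ℝ} (hR : 0 < R) (hρ : 0 < ρ) {f : ℂ → ℝ}
    (hc : ContinuousOn f (closedBall 0 R \ {0})) (hh : HarmonicOnNhd f (ball 0 R \ {0}))
    (hf : ∀ x, ‖x‖ = R → f x ≤ 0) (hb : ∀ x, 0 < ‖x‖ → ‖x‖ < ρ → f x ≤ C) :
    ∀ x, 0 < ‖x‖ → ‖x‖ < R → f x ≤ 0 := by
  intro x hx0 hxR
  have hlogx : Real.log (‖x‖ / R) < 0 := Real.log_neg (by positivity) ((div_lt_one hR).2 hxR)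
  -- The barrier δ log(‖x‖/R) vanishes on the outer circle and tends to -∞ at the puncture, where it
  -- beats the bound C. The weak maximum principle is applied on an annulus s < ‖x‖ < R with s
  -- small.
  have key : ∀ δ : ℝ, 0 < δ → f x + δ * Real.log (‖x‖ / R) ≤ 0 := by
    intro δ hδ
    have hlim : Tendsto (fun s : ℝ => C + δ * Real.log (s / R)) (𝓝[>] 0) atBot := by
      apply Filter.tendsto_atBot_add_const_left
      apply Filter.Tendsto.const_mul_atBot hδ
      apply Real.tendsto_log_nhdsGT_zero.comp
      refine tendsto_nhdsWithin_iff.2 ⟨?_, ?_⟩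
      · have : Tendsto (fun s : ℝ => s / R) (𝓝 0) (𝓝 (0 / R)) := tendsto_id.div_const R
        rw [zero_div] at this
        exact this.mono_left nhdsWithin_le_nhds
      · filter_upwards [self_mem_nhdsWithin] with s hs using div_pos hs hR
    have hev := (hlim.eventually (eventually_le_atBot 0)).and
      ((Ioo_mem_nhdsGT (lt_min hx0 hρ)))
    obtain ⟨s, hs1, hs2⟩ := hev.exists
    have hs0 : 0 < s := hs2.1
    have hsx : s < ‖x‖ := hs2.2.trans_le (min_le_left _ _)
    have hsρ : s < ρ := hs2.2.trans_le (min_le_right _ _)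
    set U : Set ℂ := {z | s < ‖z‖ ∧ ‖z‖ < R} with hUdef
    have hUo : IsOpen U := (isOpen_lt continuous_const continuous_norm).inter
      (isOpen_lt continuous_norm continuous_const)
    have hUc : closure U ⊆ {z | s ≤ ‖z‖ ∧ ‖z‖ ≤ R} :=
      closure_minimal (fun z hz => ⟨hz.1.le, hz.2.le⟩)
        ((isClosed_le continuous_const continuous_norm).inter
          (isClosed_le continuous_norm continuous_const))
    have hUb : Bornology.IsBounded U :=
      isBounded_ball.subset (fun z hz => by simpa using hz.2 : U ⊆ ball 0 R)
    refine nonpos_of_harmonicOnNhd (f := fun z => f z + δ * Real.log (‖z‖ / R)) hUo hUb ?_ ?_ ?_ x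
      ⟨hsx, hxR⟩
    · apply ContinuousOn.add
      · apply hc.mono
        intro z hz
        have := hUc hz
        refine ⟨by simpa using this.2, ?_⟩
        rintro rfl
        have := this.1
        simp at this
        linarith
      · intro z hz
        have : z ≠ 0 := by
          rintro rfl
          have := (hUc hz).1
          simp at this
          linarith
        exact ((harmonicAt_log_norm_div hR this).1.continuousAt.const_mul δ).continuousWithinAt
    · intro z hz
      have hz0 : z ≠ 0 := by
        rintro rfl
        have := hz.1
        simp at this
        linarith
      exact (hh z ⟨by simpa using hz.2, hz0⟩).add
        ((harmonicAt_log_norm_div hR hz0).const_smul (c := δ))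
    · intro z hz
      have h1 := hUc hz.1
      have h2 : ¬ (s < ‖z‖ ∧ ‖z‖ < R) := fun h => hz.2 (by rwa [hUo.interior_eq])
      rcases eq_or_lt_of_le h1.2 with h | h
      · have := hf z h
        simpa [h, hR.ne'] using this
      · have h3 : ‖z‖ = s := le_antisymm (not_lt.1 fun h' => h2 ⟨h', h⟩) h1.1
        have := hb z (h3 ▸ hs0) (h3 ▸ hsρ)
        simp only [h3]
        linarith
  by_contra! hpos
  -- This δ makes the barrier at x equal to -f x / 2, which contradicts f x > 0.
  have := key (f x / (2 * -Real.log (‖x‖ / R))) (by apply div_pos hpos; linarith)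
  have h2 : f x / (2 * -Real.log (‖x‖ / R)) * Real.log (‖x‖ / R) = - f x / 2 := by
    generalize Real.log (‖x‖ / R) = t at hlogx
    have := hlogx.ne
    field_simp
  rw [h2] at this
  linarith

/-- A bounded harmonic function on a punctured disk vanishes if it vanishes on the boundary
circle. -/
theorem eq_zero_of_harmonicOnNhd_punctured {R C ρ : ℝ} (hR : 0 < R) (hρ : 0 < ρ) {f : ℂ → ℂ}
    (hc : ContinuousOn f (closedBall 0 R \ {0})) (hh : HarmonicOnNhd f (ball 0 R \ {0}))
    (hf : ∀ x, ‖x‖ = R → f x = 0) (hb : ∀ x, 0 < ‖x‖ → ‖x‖ < ρ → ‖f x‖ ≤ C) :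
    ∀ x, 0 < ‖x‖ → ‖x‖ < R → f x = 0 := by
  intro x hx0 hxR
  have key : ∀ l : ℂ →L[ℝ] ℝ, l (f x) ≤ 0 := by
    intro l
    refine nonpos_of_harmonicOnNhd_punctured (f := fun z => l (f z)) (C := ‖l‖ * C) hR hρ
      (l.continuous.comp_continuousOn hc) (hh.comp_CLM l) (fun z hz => by simp [hf z hz]) ?_ x
      hx0 hxR
    intro z hz hz'
    exact (le_abs_self _).trans ((l.le_opNorm _).trans
      (mul_le_mul_of_nonneg_left (hb z hz hz') (norm_nonneg _)))
  apply Complex.ext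
  · have h1 := key Complex.reCLM
    have h2 := key (-Complex.reCLM)
    simp at h1 h2 ⊢
    linarith
  · have h1 := key Complex.imCLM
    have h2 := key (-Complex.imCLM)
    simp at h1 h2 ⊢
    linarith

end

section

/-! ### Uniqueness for the transmission problem on the disk -/

theorem norm_circleMap_zero_of_nonneg {r : ℝ} (hr : 0 ≤ r) (θ : ℝ) : ‖circleMap 0 r θ‖ = r := by
  simp [abs_of_nonneg hr]

theorem circleMap_norm_arg (x : ℂ) : circleMap 0 ‖x‖ x.arg = x := by
  simp [circleMap, Complex.norm_mul_exp_arg_mul_I]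

theorem circleMap_mem_closedBall {r r₀ : ℝ} (hr : r ∈ Set.Icc 0 r₀) (θ : ℝ) :
    circleMap 0 r θ ∈ closedBall (0 : ℂ) r₀ := by
  simpa [abs_of_nonneg hr.1] using hr.2

theorem circleMap_mem_compl_ball {r r₀ : ℝ} (hr₀ : 0 < r₀) (hr : r ∈ Set.Ici r₀) (θ : ℝ) :
    circleMap 0 r θ ∈ (ball (0 : ℂ) r₀)ᶜ := by
  have : r₀ ≤ r := hr
  simpa [abs_of_nonneg (hr₀.le.trans this)] using this

theorem contDiff_radial (θ : ℝ) : ContDiff ℝ 2 fun r : ℝ => circleMap 0 r θ := by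
  simp only [circleMap, zero_add]
  exact Complex.ofRealCLM.contDiff.mul contDiff_const

theorem hasDerivAt_radial (r θ : ℝ) :
    HasDerivAt (fun r : ℝ => circleMap 0 r θ) (Complex.exp (θ * Complex.I)) r := by
  simp only [circleMap, zero_add]
  simpa using (Complex.ofRealCLM.hasDerivAt (x := r)).mul_const (Complex.exp (θ * Complex.I))

namespace Potential.IsHarmonic

variable {r₀ : ℝ} {u v : Potential}

theorem contDiffOn_radial_inn (hu : u.IsHarmonic r₀) (θ : ℝ) :
    ContDiffOn ℝ 2 (fun r : ℝ => u.inn (circleMap 0 r θ)) (Set.Icc 0 r₀) :=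
  hu.contDiff_inn.comp (contDiff_radial θ).contDiffOn fun _ hr => circleMap_mem_closedBall hr θ

theorem contDiffOn_radial_out (hr₀ : 0 < r₀) (hu : u.IsHarmonic r₀) (θ : ℝ) :
    ContDiffOn ℝ 2 (fun r : ℝ => u.out (circleMap 0 r θ)) (Set.Ici r₀) :=
  hu.contDiff_out.comp (contDiff_radial θ).contDiffOn
    fun _ hr => circleMap_mem_compl_ball hr₀ hr θ

theorem hasDerivWithinAt_inn (hr₀ : 0 < r₀) (hu : u.IsHarmonic r₀) (θ : ℝ) :
    HasDerivWithinAt (fun r : ℝ => u.inn (circleMap 0 r θ)) (dνInn u r₀ θ) (Set.Icc 0 r₀) r₀ :=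
  ((hu.contDiffOn_radial_inn θ).differentiableOn two_ne_zero _
    (Set.right_mem_Icc.2 hr₀.le)).hasDerivWithinAt

theorem hasDerivWithinAt_out (hr₀ : 0 < r₀) (hu : u.IsHarmonic r₀) (θ : ℝ) :
    HasDerivWithinAt (fun r : ℝ => u.out (circleMap 0 r θ)) (dνOut u r₀ θ) (Set.Ici r₀) r₀ :=
  ((hu.contDiffOn_radial_out hr₀ θ).differentiableOn two_ne_zero _
    Set.self_mem_Ici).hasDerivWithinAt

end Potential.IsHarmonic

/-- The inversion in the circle of radius `R`. -/
noncomputable def inversion (R : ℝ) (x : ℂ) : ℂ := starRingEnd ℂ ((R : ℂ) ^ 2 / x)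

theorem norm_inversion (R : ℝ) (x : ℂ) : ‖inversion R x‖ = R ^ 2 / ‖x‖ := by
  simp [inversion]

theorem inversion_circleMap {R r : ℝ} (θ : ℝ) :
    inversion R (circleMap 0 r θ) = circleMap 0 (R ^ 2 / r) θ := by
  simp only [inversion, circleMap, zero_add, map_div₀, map_pow, map_mul, Complex.conj_ofReal,
    ← Complex.exp_conj, Complex.conj_I, Complex.ofReal_div, Complex.ofReal_pow, mul_neg,
    Complex.exp_neg]
  rw [div_mul_eq_div_div, div_inv_eq_mul]

/-- Reflection: a potential that is continuous across the circle and bounded at infinity is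
symmetric under inversion. -/
theorem out_inversion_eq_inn {r₀ : ℝ} (hr₀ : 0 < r₀) {u : Potential} (hu : u.IsHarmonic r₀)
    (htr : ∀ θ : ℝ, u.out (circleMap 0 r₀ θ) = u.inn (circleMap 0 r₀ θ))
    (hb : u.out =O[Bornology.cobounded ℂ] fun _ => (1 : ℝ)) {x : ℂ} (hx0 : 0 < ‖x‖)
    (hxR : ‖x‖ ≤ r₀) : u.out (inversion r₀ x) = u.inn x := by
  have hsphere : ∀ y : ℂ, ‖y‖ = r₀ → u.out (inversion r₀ y) - u.inn y = 0 := by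
    intro y hy
    have h1 : y = circleMap 0 r₀ y.arg := by rw [← hy, circleMap_norm_arg]
    rw [h1, inversion_circleMap, pow_two, mul_self_div_self, htr, sub_self]
  rcases eq_or_lt_of_le hxR with h | h
  · exact sub_eq_zero.1 (hsphere x h)
  have hmem : ∀ y ∈ closedBall (0 : ℂ) r₀ \ {0}, inversion r₀ y ∈ (ball (0 : ℂ) r₀)ᶜ := by
    intro y hy
    have hy0 : 0 < ‖y‖ := norm_pos_iff.2 hy.2
    have hy1 : ‖y‖ ≤ r₀ := by simpa using hy.1
    simp only [Set.mem_compl_iff, mem_ball_zero_iff, norm_inversion, not_lt]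
    rw [le_div_iff₀ hy0, pow_two]
    exact mul_le_mul_of_nonneg_left hy1 hr₀.le
  have han : ∀ y : ℂ, y ≠ 0 → AnalyticAt ℂ (fun y => (r₀ : ℂ) ^ 2 / y) y := fun y hy =>
    analyticAt_const.div analyticAt_id hy
  have hcont : ContinuousOn (inversion r₀) (closedBall 0 r₀ \ {0}) := fun y hy =>
    (Complex.continuous_conj.continuousAt.comp (han y hy.2).continuousAt).continuousWithinAt
  obtain ⟨C, hC⟩ := hb.bound
  obtain ⟨S, hS⟩ := (hasBasis_cobounded_norm (E := ℂ)).eventually_iff.1 hC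
  obtain ⟨hST, hS⟩ := hS
  obtain ⟨B, hB⟩ := (isCompact_closedBall (0 : ℂ) r₀).exists_bound_of_continuousOn
    hu.contDiff_inn.continuousOn
  -- The difference of the reflected outer part and the inner part is bounded at the puncture
  -- because the outer part is bounded at infinity. For ‖y‖ < r₀²/max S 1 the reflected point has
  -- norm at least S; the maximum with 1 keeps the radius positive.
  refine sub_eq_zero.1 (eq_zero_of_harmonicOnNhd_punctured
    (f := fun y => u.out (inversion r₀ y) - u.inn y) (C := C + B)
    (ρ := min r₀ (r₀ ^ 2 / (max S 1))) hr₀ (lt_min hr₀ (by positivity)) ?_ ?_ hsphere ?_ x hx0 h)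
  · exact (hu.contDiff_out.continuousOn.comp hcont hmem).sub
      (hu.contDiff_inn.continuousOn.mono Set.sdiff_subset)
  · intro y hy
    refine HarmonicAt.sub (f₁ := fun y => u.out (inversion r₀ y))
      (HarmonicAt.comp_conj_analyticAt (han y hy.2) (hu.harmonic_out _ ?_))
      (hu.harmonic_inn y hy.1)
    have hy0 : 0 < ‖y‖ := norm_pos_iff.2 hy.2
    have hy1 : ‖y‖ < r₀ := by simpa using hy.1
    change inversion r₀ y ∈ _
    simp only [Set.mem_compl_iff, mem_closedBall_zero_iff, norm_inversion, not_le]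
    rw [lt_div_iff₀ hy0, pow_two]
    exact mul_lt_mul_of_pos_left hy1 hr₀
  · intro y hy0 hyρ
    have hy1 : ‖y‖ < r₀ := hyρ.trans_le (min_le_left _ _)
    have hy2 : ‖y‖ < r₀ ^ 2 / max S 1 := hyρ.trans_le (min_le_right _ _)
    have h1 : ‖u.out (inversion r₀ y)‖ ≤ C * ‖(1 : ℝ)‖ := by
      apply hS
      change S ≤ ‖inversion r₀ y‖
      rw [norm_inversion, le_div_iff₀ hy0]
      rw [lt_div_iff₀ (by positivity), mul_comm] at hy2
      exact (mul_le_mul_of_nonneg_right (le_max_left S 1) hy0.le).trans hy2.le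
    have h2 := hB y (by simpa using hy1.le)
    rw [norm_one, mul_one] at h1
    exact (norm_sub_le _ _).trans (add_le_add h1 h2)

/-- Uniqueness up to constants for the Neumann problem on the disk. -/
theorem inn_eq_const_of_neumann {r₀ : ℝ} (hr₀ : 0 < r₀) {u : Potential} (hu : u.IsHarmonic r₀)
    (hν : ∀ θ : ℝ, dνInn u r₀ θ = 0) : ∀ x : ℂ, ‖x‖ < r₀ → u.inn x = u.inn 0 := by
  set K := closedBall (0 : ℂ) r₀
  have hKu : UniqueDiffOn ℝ K := uniqueDiffOn_convex (convex_closedBall (0 : ℂ) r₀)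
    (by rw [interior_closedBall _ hr₀.ne']; exact nonempty_ball.2 hr₀)
  -- The Euler derivative g(x) = x·∇u is harmonic, continuous up to the circle, and equal there to
  -- r₀ ∂u/∂ν = 0. Hence g vanishes, and u is constant along every ray.
  set g : ℂ → ℂ := fun x => fderivWithin ℝ u.inn K x x
  have hdiff : DifferentiableOn ℝ u.inn K := hu.contDiff_inn.differentiableOn two_ne_zero
  have hgc : ContinuousOn g K :=
    (hu.contDiff_inn.continuousOn_fderivWithin hKu one_le_two).clm_apply continuousOn_id
  have hg : ∀ x ∈ ball (0 : ℂ) r₀, g x = fderiv ℝ u.inn x x := fun x hx => by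
    change fderivWithin ℝ u.inn K x x = _
    rw [fderivWithin_of_mem_nhds (Filter.mem_of_superset (isOpen_ball.mem_nhds hx)
      ball_subset_closedBall)]
  -- If p = Re F, then x·∇p = Re (z F'(z)).
  have hreal : ∀ p : ℂ → ℝ, HarmonicOnNhd p (ball 0 r₀) →
      HarmonicOnNhd (fun x => fderiv ℝ p x x) (ball 0 r₀) := by
    intro p hp x hx
    obtain ⟨F, hF, hFp⟩ := HarmonicOnNhd.exists_analyticOnNhd_ball_re_eq hp
    have h1 : AnalyticAt ℂ (fun z => deriv F z * z) x := (hF x hx).deriv.mul analyticAt_id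
    refine (harmonicAt_congr_nhds ?_).2 h1.harmonicAt_re
    filter_upwards [isOpen_ball.mem_nhds hx] with z hz
    have h2 : p =ᶠ[𝓝 z] fun z => (F z).re := by
      filter_upwards [isOpen_ball.mem_nhds hz] with w hw using (hFp hw).symm
    have h3 : HasFDerivAt (fun z => (F z).re) (Complex.reCLM.comp
        ((ContinuousLinearMap.toSpanSingleton ℂ (deriv F z)).restrictScalars ℝ)) z :=
      Complex.reCLM.hasFDerivAt.comp z
        ((hF z hz).differentiableAt.hasDerivAt.hasFDerivAt.restrictScalars ℝ)
    rw [h2.fderiv_eq, h3.fderiv]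
    simp [mul_comm]
  have hgh : HarmonicOnNhd g (ball 0 r₀) := by
    intro x hx
    have hcomp : ∀ l : ℂ →L[ℝ] ℝ, HarmonicAt (fun z => l (g z)) x := by
      intro l
      refine (harmonicAt_congr_nhds ?_).2 (hreal _ (hu.harmonic_inn.comp_CLM l) x hx)
      filter_upwards [isOpen_ball.mem_nhds hx] with z hz
      have hd : DifferentiableAt ℝ u.inn z :=
        (hu.harmonic_inn z hz).1.differentiableAt two_ne_zero
      rw [hg z hz, (l.hasFDerivAt.comp z hd.hasFDerivAt).fderiv]
      rfl
    exact harmonicAt_of_re_im (hcomp Complex.reCLM) (hcomp Complex.imCLM)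
  have hgs : ∀ x ∈ sphere (0 : ℂ) r₀, g x = 0 := by
    intro x hx
    have hx' : ‖x‖ = r₀ := by simpa using hx
    have hxe : circleMap 0 r₀ x.arg = x := by rw [← hx', circleMap_norm_arg]
    have h1 := (hdiff x (sphere_subset_closedBall hx)).hasFDerivWithinAt
    rw [← hxe] at h1
    have h2 := h1.comp_hasDerivWithinAt r₀ (hasDerivAt_radial r₀ x.arg).hasDerivWithinAt
      (fun r (hr : r ∈ Set.Icc 0 r₀) => circleMap_mem_closedBall hr x.arg)
    have h3 := (uniqueDiffOn_Icc hr₀ r₀ (Set.right_mem_Icc.2 hr₀.le)).eq_deriv _ h2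
      (hu.hasDerivWithinAt_inn hr₀ x.arg)
    rw [hν, hxe] at h3
    have h4 : x = r₀ • Complex.exp (x.arg * Complex.I) := by
      conv_lhs => rw [← hxe]
      simp [circleMap]
    change fderivWithin ℝ u.inn K x x = 0
    conv_lhs => arg 2; rw [h4]
    rw [map_smul, h3, smul_zero]
  have hg0 : ∀ x ∈ ball (0 : ℂ) r₀, g x = 0 := by
    intro x hx
    rcases eq_or_ne x 0 with rfl | hx0
    · exact map_zero _
    obtain ⟨B, hB⟩ := (isCompact_closedBall (0 : ℂ) r₀).exists_bound_of_continuousOn hgc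
    exact eq_zero_of_harmonicOnNhd_punctured hr₀ hr₀ (hgc.mono Set.sdiff_subset)
      (hgh.mono Set.sdiff_subset) (fun y hy => hgs y (by simpa using hy))
      (fun y _ hy => hB y (by simpa using hy.le)) x (norm_pos_iff.2 hx0) (by simpa using hx)
  intro x hx
  have hseg : ∀ t ∈ Set.Icc (0 : ℝ) 1, (1 - t) • x ∈ ball (0 : ℂ) r₀ := by
    intro t ht
    rw [mem_ball_zero_iff, norm_smul, Real.norm_eq_abs, abs_of_nonneg (by linarith [ht.2])]
    exact (mul_le_of_le_one_left (norm_nonneg x) (by linarith [ht.1])).trans_lt hx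
  -- Along the segment (1 - t)x the derivative is -∇u·x, while g = 0 gives (1 - t)∇u·x = 0. A right
  -- derivative is needed only for t < 1, where 1 - t can be cancelled, so the origin causes no
  -- trouble.
  have hconst := constant_of_has_deriv_right_zero (f := fun t : ℝ => u.inn ((1 - t) • x))
    (a := 0) (b := 1) ?_ ?_ 1 (by simp)
  · simpa using hconst.symm
  · refine (hdiff.continuousOn).comp (by fun_prop) fun t ht => ball_subset_closedBall (hseg t ht)
  · intro t ht
    have hmem := hseg t ⟨ht.1, ht.2.le⟩
    have hd : DifferentiableAt ℝ u.inn ((1 - t) • x) :=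
      (hu.harmonic_inn _ hmem).1.differentiableAt two_ne_zero
    have h1 : HasDerivAt (fun t : ℝ => (1 - t) • x) (-x) t := by
      simpa using ((hasDerivAt_id t).const_sub 1).smul_const x
    have h2 := hd.hasFDerivAt.comp_hasDerivAt t h1
    have h3 : fderiv ℝ u.inn ((1 - t) • x) x = 0 := by
      have h4 := hg0 _ hmem
      rw [hg _ hmem, map_smul] at h4
      exact (smul_eq_zero.1 h4).resolve_left (by linarith [ht.2])
    rw [map_neg, h3, neg_zero] at h2
    exact h2.hasDerivWithinAt

/-- Uniqueness for the transmission problem with contrast `ε ≠ -1`. -/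
theorem eq_zero_of_transmission {r₀ : ℝ} (hr₀ : 0 < r₀) {eps : ℂ} (heps : eps ≠ -1)
    {u : Potential} (hu : u.IsHarmonic r₀)
    (htr : ∀ θ : ℝ, u.out (circleMap 0 r₀ θ) = u.inn (circleMap 0 r₀ θ))
    (hfl : ∀ θ : ℝ, dνOut u r₀ θ = eps * dνInn u r₀ θ)
    (hdec : Tendsto u.out (Bornology.cobounded ℂ) (𝓝 0)) :
    (∀ x ∈ closedBall (0 : ℂ) r₀, u.inn x = 0) ∧ ∀ x ∈ (ball (0 : ℂ) r₀)ᶜ, u.out x = 0 := by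
  have hrefl := fun {x : ℂ} => out_inversion_eq_inn (x := x) hr₀ hu htr (hdec.isBigO_one ℝ)
  have hray : ∀ θ : ℝ, ∀ s ∈ Set.Ici r₀,
      u.out (circleMap 0 s θ) = u.inn (circleMap 0 (r₀ ^ 2 / s) θ) := by
    intro θ s hs
    have hs' : r₀ ≤ s := hs
    have hs0 : 0 < s := hr₀.trans_le hs'
    have hpos : 0 < r₀ ^ 2 / s := by positivity
    rw [← hrefl (x := circleMap 0 (r₀ ^ 2 / s) θ), inversion_circleMap]
    · congr 2
      field_simp
    · rwa [norm_circleMap_zero_of_nonneg hpos.le]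
    · rw [norm_circleMap_zero_of_nonneg hpos.le, div_le_iff₀ hs0, pow_two]
      exact mul_le_mul_of_nonneg_left hs' hr₀.le
  -- The radial inversion s ↦ r₀²/s fixes r₀ with derivative -1, so reflection reverses the normal
  -- derivative.
  have hneg : ∀ θ : ℝ, dνOut u r₀ θ = -dνInn u r₀ θ := by
    intro θ
    have hdiv : HasDerivWithinAt (fun s : ℝ => r₀ ^ 2 / s) (-1) (Set.Ici r₀) r₀ := by
      have := (hasDerivAt_inv hr₀.ne').const_mul (r₀ ^ 2)
      rw [mul_neg, mul_inv_cancel₀ (pow_ne_zero 2 hr₀.ne')] at this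
      simpa only [← div_eq_mul_inv] using this.hasDerivWithinAt
    have h0 : r₀ ^ 2 / r₀ = r₀ := by field_simp
    have h1 := hu.hasDerivWithinAt_inn hr₀ θ
    rw [← h0] at h1
    have hmaps : Set.MapsTo (fun s : ℝ => r₀ ^ 2 / s) (Set.Ici r₀) (Set.Icc 0 (r₀ ^ 2 / r₀)) := by
      intro s hs
      have hs' : r₀ ≤ s := hs
      have hs0 : 0 < s := hr₀.trans_le hs'
      exact ⟨by positivity, div_le_div_of_nonneg_left (by positivity) hr₀ hs'⟩
    have h2 := h1.scomp r₀ hdiv hmaps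
    rw [h0] at h2
    have h3 := (h2.congr (fun s hs => hray θ s hs) (hray θ r₀ Set.self_mem_Ici))
    rw [(uniqueDiffOn_Ici r₀ r₀ Set.self_mem_Ici).eq_deriv _
      (hu.hasDerivWithinAt_out hr₀ θ) h3]
    simp
  -- Together with the flux condition this gives (1 + ε) ∂u/∂ν|₋ = 0, the only place where ε ≠ -1
  -- enters.
  have hν : ∀ θ : ℝ, dνInn u r₀ θ = 0 := by
    intro θ
    have h1 : (1 + eps) * dνInn u r₀ θ = 0 := by
      linear_combination hneg θ - hfl θ
    refine (mul_eq_zero.1 h1).resolve_left fun h => heps ?_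
    linear_combination h
  have hinn : ∀ x ∈ closedBall (0 : ℂ) r₀, u.inn x = u.inn 0 := by
    have hcl : closure (ball (0 : ℂ) r₀) = closedBall 0 r₀ := closure_ball _ hr₀.ne'
    intro x hx
    have := Set.EqOn.of_subset_closure (s := ball (0 : ℂ) r₀) (t := closedBall 0 r₀)
      (f := u.inn) (g := fun _ => u.inn 0)
      (fun y hy => inn_eq_const_of_neumann hr₀ hu hν y (by simpa using hy))
      hu.contDiff_inn.continuousOn continuousOn_const ball_subset_closedBall hcl.ge
    exact this hx
  have hout : ∀ x ∈ (ball (0 : ℂ) r₀)ᶜ, u.out x = u.inn 0 := by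
    intro x hx
    have hx' : r₀ ≤ ‖x‖ := by simpa using hx
    have hx0 : 0 < ‖x‖ := hr₀.trans_le hx'
    rw [← circleMap_norm_arg x, hray _ _ hx']
    apply hinn
    apply circleMap_mem_closedBall
    refine ⟨by positivity, ?_⟩
    rw [div_le_iff₀ hx0, pow_two]
    exact mul_le_mul_of_nonneg_left hx' hr₀.le
  have h0 : u.inn 0 = 0 := by
    refine tendsto_nhds_unique (tendsto_const_nhds.congr' ?_) hdec
    filter_upwards [Bornology.isBounded_def.1 (isBounded_ball (x := (0 : ℂ)) (r := r₀))] with x hx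
    exact (hout x hx).symm
  exact ⟨fun x hx => (hinn x hx).trans h0, fun x hx => (hout x hx).trans h0⟩

end

section

/-! ### Uniqueness of the expansion -/

/-- Two potentials agree on the closed disk and on the closed exterior. -/
def Potential.Agree (r₀ : ℝ) (u v : Potential) : Prop :=
  Set.EqOn u.inn v.inn (closedBall 0 r₀) ∧ Set.EqOn u.out v.out (ball 0 r₀)ᶜ

namespace Potential.Agree

variable {r₀ : ℝ} {u v : Potential}

/-- Each boundary quantity is a derivative within one closed side or along a circle contained in it,
so agreement on the closed sets is enough. -/
theorem dνInn (hr₀ : 0 < r₀) (h : u.Agree r₀ v) : dνInn u r₀ = dνInn v r₀ := by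
  funext θ
  exact derivWithin_congr (fun r hr => h.1 (circleMap_mem_closedBall hr θ))
    (h.1 (circleMap_mem_closedBall (Set.right_mem_Icc.2 hr₀.le) θ))

theorem dνOut (hr₀ : 0 < r₀) (h : u.Agree r₀ v) : dνOut u r₀ = dνOut v r₀ := by
  funext θ
  exact derivWithin_congr (fun r hr => h.2 (circleMap_mem_compl_ball hr₀ hr θ))
    (h.2 (circleMap_mem_compl_ball hr₀ Set.self_mem_Ici θ))

theorem dννInn (hr₀ : 0 < r₀) (h : u.Agree r₀ v) : dννInn u r₀ = dννInn v r₀ := by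
  funext θ
  exact iteratedDerivWithin_congr (fun r hr => h.1 (circleMap_mem_closedBall hr θ))
    (Set.right_mem_Icc.2 hr₀.le)

theorem dννOut (hr₀ : 0 < r₀) (h : u.Agree r₀ v) : dννOut u r₀ = dννOut v r₀ := by
  funext θ
  exact iteratedDerivWithin_congr (fun r hr => h.2 (circleMap_mem_compl_ball hr₀ hr θ))
    Set.self_mem_Ici

theorem dT_inn {r : ℝ} (h : u.Agree r₀ v) (hr : r ∈ Set.Icc 0 r₀) : dT u.inn r = dT v.inn r := by
  funext θ
  have : (fun φ : ℝ => u.inn (circleMap 0 r φ)) = fun φ : ℝ => v.inn (circleMap 0 r φ) :=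
    funext fun φ => h.1 (circleMap_mem_closedBall hr φ)
  rw [dT, this, dT]

theorem dT_out (hr₀ : 0 < r₀) (h : u.Agree r₀ v) : dT u.out r₀ = dT v.out r₀ := by
  funext θ
  have : (fun φ : ℝ => u.out (circleMap 0 r₀ φ)) = fun φ : ℝ => v.out (circleMap 0 r₀ φ) :=
    funext fun φ => h.2 (circleMap_mem_compl_ball hr₀ Set.self_mem_Ici φ)
  rw [dT, this, dT]

theorem dνTInn (hr₀ : 0 < r₀) (h : u.Agree r₀ v) : dνTInn u r₀ = dνTInn v r₀ := by
  funext θ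
  exact derivWithin_congr (fun r hr => congrFun (h.dT_inn hr) θ)
    (congrFun (h.dT_inn (Set.right_mem_Icc.2 hr₀.le)) θ)

end Potential.Agree

/-- The transmission problem with contrast `ε ≠ -1` and prescribed jumps determines the
potential. -/
theorem agree_of_transmission {r₀ : ℝ} (hr₀ : 0 < r₀) {eps : ℂ} (heps : eps ≠ -1)
    {u v : Potential} (hu : u.IsHarmonic r₀) (hv : v.IsHarmonic r₀)
    (htr : ∀ θ : ℝ, u.out (circleMap 0 r₀ θ) - u.inn (circleMap 0 r₀ θ)
      = v.out (circleMap 0 r₀ θ) - v.inn (circleMap 0 r₀ θ))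
    (hfl : ∀ θ : ℝ, dνOut u r₀ θ - eps * dνInn u r₀ θ = dνOut v r₀ θ - eps * dνInn v r₀ θ)
    (hdec : Tendsto (fun x => u.out x - v.out x) (Bornology.cobounded ℂ) (𝓝 0)) :
    u.Agree r₀ v := by
  set w : Potential := ⟨u.inn - v.inn, u.out - v.out⟩
  have hw : w.IsHarmonic r₀ :=
    ⟨hu.contDiff_inn.sub hv.contDiff_inn, hu.contDiff_out.sub hv.contDiff_out,
      hu.harmonic_inn.sub hv.harmonic_inn, hu.harmonic_out.sub hv.harmonic_out⟩
  have hin : ∀ θ : ℝ, dνInn w r₀ θ = dνInn u r₀ θ - dνInn v r₀ θ := fun θ =>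
    ((hu.hasDerivWithinAt_inn hr₀ θ).sub (hv.hasDerivWithinAt_inn hr₀ θ)).derivWithin
      (uniqueDiffOn_Icc hr₀ r₀ (Set.right_mem_Icc.2 hr₀.le))
  have hou : ∀ θ : ℝ, dνOut w r₀ θ = dνOut u r₀ θ - dνOut v r₀ θ := fun θ =>
    ((hu.hasDerivWithinAt_out hr₀ θ).sub (hv.hasDerivWithinAt_out hr₀ θ)).derivWithin
      (uniqueDiffOn_Ici r₀ r₀ Set.self_mem_Ici)
  have h := eq_zero_of_transmission hr₀ heps hw (fun θ => ?_) (fun θ => ?_) hdec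
  · exact ⟨fun x hx => sub_eq_zero.1 (h.1 x hx), fun x hx => sub_eq_zero.1 (h.2 x hx)⟩
  · simp only [w, Pi.sub_apply]
    linear_combination htr θ
  · rw [hin, hou]
    linear_combination hfl θ

theorem tendsto_inv_norm_pow_cobounded {m : ℕ} (hm : m ≠ 0) :
    Tendsto (fun x : ℂ => (‖x‖ ^ m)⁻¹) (Bornology.cobounded ℂ) (𝓝 0) :=
  tendsto_inv_atTop_zero.comp ((tendsto_pow_atTop hm).comp tendsto_norm_cobounded_atTop)

theorem tendsto_inv_norm_cobounded :
    Tendsto (fun x : ℂ => ‖x‖⁻¹) (Bornology.cobounded ℂ) (𝓝 0) :=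
  tendsto_inv_atTop_zero.comp tendsto_norm_cobounded_atTop

/-- The second-harmonic first-order potential is determined by the coupled systems. -/
theorem IsExpansion.agree {μ : Medium} {E r₀ : ℝ} {ℓ n : ℕ} (hr₀ : 0 < r₀) (he : μ.epsω ≠ -1)
    (hd : μ.eps2ω ≠ -1) {u₀ v₀ u₁ v₁ u₀' v₀' u₁' v₁' : Potential}
    (h : IsExpansion μ E r₀ ℓ n u₀ v₀ u₁ v₁) (h' : IsExpansion μ E r₀ ℓ n u₀' v₀' u₁' v₁') :
    v₁.Agree r₀ v₁' := by
  obtain ⟨h0, h1⟩ := h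
  obtain ⟨h0', h1'⟩ := h'
  have hr₀mem : r₀ ∈ Set.Icc 0 r₀ := Set.right_mem_Icc.2 hr₀.le
  -- The problems are triangular: u₀ fixes the sources of v₀ and of u₁, and these three fix the
  -- sources of v₁.
  have a0 : u₀.Agree r₀ u₀' := by
    refine agree_of_transmission hr₀ he h0.harmonic_u h0'.harmonic_u
      (fun θ => by rw [h0.trace_u, h0'.trace_u, sub_self, sub_self])
      (fun θ => by rw [h0.flux_u, h0'.flux_u, sub_self, sub_self]) ?_
    have := (h0.decay_u.sub h0'.decay_u).trans_tendsto tendsto_inv_norm_cobounded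
    simpa using this
  have hP0 : Pperp0 μ r₀ u₀ = Pperp0 μ r₀ u₀' := by
    funext θ
    simp only [Pperp0, a0.dνInn hr₀]
  have hQ0 : Ppar0 μ r₀ u₀ = Ppar0 μ r₀ u₀' := by
    funext θ
    simp only [Ppar0, a0.dνInn hr₀, a0.dT_inn hr₀mem]
  have hs0 : sigma0 μ r₀ u₀ = sigma0 μ r₀ u₀' := by
    funext θ
    simp only [sigma0, hQ0]
  have b0 : v₀.Agree r₀ v₀' := by
    refine agree_of_transmission hr₀ hd h0.harmonic_v h0'.harmonic_v
      (fun θ => by rw [h0.trace_v, h0'.trace_v, hP0])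
      (fun θ => by rw [h0.flux_v, h0'.flux_v, hs0]) ?_
    exact (h0.decay_v.sub h0'.decay_v).trans_tendsto (tendsto_inv_norm_pow_cobounded two_ne_zero)
  have hJ : ∀ {w w' : Potential} (f : ℝ → ℝ), w.Agree r₀ w' →
      jump1 r₀ f w = jump1 r₀ f w' := fun f hw => by
    funext θ
    simp only [jump1, hw.dνInn hr₀, hw.dνOut hr₀]
  have hK : ∀ {w w' : Potential} (eps : ℂ) (f : ℝ → ℝ), w.Agree r₀ w' →
      fluxJump1 eps r₀ f w = fluxJump1 eps r₀ f w' := fun eps f hw => by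
    funext θ
    simp only [fluxJump1, hw.dννInn hr₀, hw.dννOut hr₀, hw.dT_out hr₀, hw.dT_inn hr₀mem]
  have a1 : u₁.Agree r₀ u₁' := by
    refine agree_of_transmission hr₀ he h1.harmonic_u h1'.harmonic_u
      (fun θ => by rw [h1.trace_u, h1'.trace_u, hJ _ a0])
      (fun θ => by rw [h1.flux_u, h1'.flux_u, hK _ _ a0]) ?_
    exact (h1.decay_u.sub h1'.decay_u).trans_tendsto tendsto_inv_norm_cobounded
  have hN : ∀ f : ℝ → ℝ, normal1 r₀ f u₀ u₁ = normal1 r₀ f u₀' u₁' := fun f => by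
    funext θ
    simp only [normal1, a1.dνInn hr₀, a0.dννInn hr₀, a0.dT_inn hr₀mem]
  have hT : ∀ f : ℝ → ℝ, tangential1 r₀ f u₀ u₁ = tangential1 r₀ f u₀' u₁' := fun f => by
    funext θ
    simp only [tangential1, a1.dT_inn hr₀mem, a0.dνTInn hr₀, a0.dνInn hr₀]
  have hP1 : ∀ f : ℝ → ℝ, Pperp1 μ r₀ f u₀ u₁ = Pperp1 μ r₀ f u₀' u₁' := fun f => by
    funext θ
    simp only [Pperp1, hN, a0.dνInn hr₀]
  have hQ1 : ∀ f : ℝ → ℝ, Ppar1 μ r₀ f u₀ u₁ = Ppar1 μ r₀ f u₀' u₁' := fun f => by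
    funext θ
    simp only [Ppar1, hN, hT, a0.dνInn hr₀, a0.dT_inn hr₀mem]
  have hs1 : ∀ f : ℝ → ℝ, sigma1 μ r₀ f u₀ u₁ = sigma1 μ r₀ f u₀' u₁' := fun f => by
    funext θ
    simp only [sigma1, hQ0, hQ1]
  refine agree_of_transmission hr₀ hd h1.harmonic_v h1'.harmonic_v
    (fun θ => by rw [h1.trace_v, h1'.trace_v, hJ _ b0, hP1])
    (fun θ => by rw [h1.flux_v, h1'.flux_v, hK _ _ b0, hs1]) ?_
  simpa using h1.decay_v.sub h1'.decay_v

end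

section

/-! ### Angular modes -/

/-- `cos(kθ)` as a complex number. -/
noncomputable def cosMode (k : ℤ) (θ : ℝ) : ℂ := (Real.cos (k * θ) : ℝ)

/-- `sin(kθ)` as a complex number. -/
noncomputable def sinMode (k : ℤ) (θ : ℝ) : ℂ := (Real.sin (k * θ) : ℝ)

theorem cosMode_zero (θ : ℝ) : cosMode 0 θ = 1 := by simp [cosMode]

theorem cosMode_neg (k : ℤ) (θ : ℝ) : cosMode (-k) θ = cosMode k θ := by simp [cosMode]

theorem sinMode_neg (k : ℤ) (θ : ℝ) : sinMode (-k) θ = -sinMode k θ := by simp [sinMode]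

theorem cosMode_abs (k : ℤ) (θ : ℝ) : cosMode |k| θ = cosMode k θ := by
  rcases abs_choice k with h | h <;> rw [h]
  exact cosMode_neg k θ

theorem cosMode_add (j k : ℤ) (θ : ℝ) :
    cosMode (j + k) θ = cosMode j θ * cosMode k θ - sinMode j θ * sinMode k θ := by
  simp only [cosMode, sinMode, Int.cast_add, add_mul, Real.cos_add, Complex.ofReal_sub,
    Complex.ofReal_mul]

theorem sinMode_add (j k : ℤ) (θ : ℝ) :
    sinMode (j + k) θ = sinMode j θ * cosMode k θ + cosMode j θ * sinMode k θ := by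
  simp only [cosMode, sinMode, Int.cast_add, add_mul, Real.sin_add, Complex.ofReal_add,
    Complex.ofReal_mul]

theorem cosMode_sub (j k : ℤ) (θ : ℝ) :
    cosMode (j - k) θ = cosMode j θ * cosMode k θ + sinMode j θ * sinMode k θ := by
  rw [sub_eq_add_neg, cosMode_add, cosMode_neg, sinMode_neg]; ring

theorem sinMode_sub (j k : ℤ) (θ : ℝ) :
    sinMode (j - k) θ = sinMode j θ * cosMode k θ - cosMode j θ * sinMode k θ := by
  rw [sub_eq_add_neg, sinMode_add, cosMode_neg, sinMode_neg]; ring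

theorem sinMode_sq_add_cosMode_sq (k : ℤ) (θ : ℝ) : sinMode k θ ^ 2 + cosMode k θ ^ 2 = 1 := by
  simp only [cosMode, sinMode]
  exact_mod_cast Real.sin_sq_add_cos_sq (k * θ)

theorem norm_cosMode_le (k : ℤ) (θ : ℝ) : ‖cosMode k θ‖ ≤ 1 := by
  rw [cosMode, Complex.norm_real]
  exact Real.abs_cos_le_one _

theorem hasDerivAt_cosMode (k : ℤ) (θ : ℝ) : HasDerivAt (cosMode k) (-(k * sinMode k θ)) θ := by
  have h : HasDerivAt (fun φ : ℝ => (k : ℝ) * φ) k θ := by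
    simpa using (hasDerivAt_id θ).const_mul (k : ℝ)
  refine h.cos.ofReal_comp.congr_deriv ?_
  rw [sinMode]
  push_cast
  ring

theorem hasDerivAt_sinMode (k : ℤ) (θ : ℝ) : HasDerivAt (sinMode k) (k * cosMode k θ) θ := by
  have h : HasDerivAt (fun φ : ℝ => (k : ℝ) * φ) k θ := by
    simpa using (hasDerivAt_id θ).const_mul (k : ℝ)
  refine h.sin.ofReal_comp.congr_deriv ?_
  rw [cosMode]
  push_cast
  ring

/-! ### Finite sums of harmonic modes -/

/-- The harmonic function `∑ᵢ bᵢ (r/r₀)^{kᵢ} cos(kᵢ θ)`. -/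
noncomputable def modal (r₀ : ℝ) {m : ℕ} (k : Fin m → ℤ) (b : Fin m → ℂ) (x : ℂ) : ℂ :=
  ∑ i, b i * (((x / r₀) ^ k i).re : ℂ)

variable {r₀ : ℝ} {m : ℕ} {k : Fin m → ℤ} {b : Fin m → ℂ}

theorem modal_circleMap (r θ : ℝ) : modal r₀ k b (circleMap 0 r θ)
    = ∑ i, b i * (((r / r₀) ^ k i : ℝ) : ℂ) * cosMode (k i) θ := by
  refine Finset.sum_congr rfl fun i _ => ?_
  have h1 : (circleMap 0 r θ / r₀) ^ k i
      = (((r / r₀) ^ k i : ℝ) : ℂ) * Complex.exp (((k i * θ : ℝ) : ℂ) * Complex.I) := by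
    rw [circleMap, zero_add, mul_div_right_comm, mul_zpow, ← Complex.exp_int_mul]
    push_cast
    ring_nf
  rw [h1, Complex.re_ofReal_mul, Complex.exp_ofReal_mul_I_re, cosMode, mul_assoc]
  push_cast
  rfl

theorem modal_circleMap_self (hr₀ : 0 < r₀) (θ : ℝ) :
    modal r₀ k b (circleMap 0 r₀ θ) = ∑ i, b i * cosMode (k i) θ := by
  rw [modal_circleMap]
  simp [div_self hr₀.ne']

theorem analyticAt_mode (hr₀ : 0 < r₀) {j : ℤ} {x : ℂ} (h : x ≠ 0 ∨ 0 ≤ j) :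
    AnalyticAt ℂ (fun x : ℂ => (x / r₀) ^ j) x := by
  have h1 : AnalyticAt ℂ (fun x : ℂ => x / (r₀ : ℂ)) x := by fun_prop
  rcases h with h | h
  · exact h1.zpow (div_ne_zero h (by exact_mod_cast hr₀.ne'))
  · lift j to ℕ using h
    simp only [zpow_natCast]
    exact h1.fun_pow j

theorem harmonicAt_modal (hr₀ : 0 < r₀) {x : ℂ} (h : ∀ i, x ≠ 0 ∨ 0 ≤ k i) :
    HarmonicAt (modal r₀ k b) x := by
  have hs : ∀ s : Finset (Fin m),
      HarmonicAt (fun x : ℂ => ∑ i ∈ s, b i * (((x / r₀) ^ k i).re : ℂ)) x := by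
    intro s
    induction s using Finset.cons_induction with
    | empty => exact AnalyticAt.harmonicAt (analyticAt_const (v := (0 : ℂ)) (x := x))
    | cons a s ha ih =>
      simp only [Finset.sum_cons]
      exact ((analyticAt_mode hr₀ (h a)).harmonicAt_re.comp_CLM
        (b a • Complex.ofRealCLM)).add ih
  exact hs Finset.univ

theorem isHarmonic_modal (hr₀ : 0 < r₀) {m' : ℕ} {k' : Fin m' → ℤ} {b' : Fin m' → ℂ}
    (hk : ∀ i, 0 ≤ k i) :
    Potential.IsHarmonic r₀ ⟨modal r₀ k b, modal r₀ k' b'⟩ := by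
  have h0 : ∀ x ∈ (ball (0 : ℂ) r₀)ᶜ, x ≠ 0 := by
    rintro x hx rfl
    exact hx (mem_ball_self hr₀)
  exact ⟨fun x _ => (harmonicAt_modal hr₀ fun i => Or.inr (hk i)).1.contDiffWithinAt,
    fun x hx => (harmonicAt_modal hr₀ fun i => Or.inl (h0 x hx)).1.contDiffWithinAt,
    fun x _ => harmonicAt_modal hr₀ fun i => Or.inr (hk i),
    fun x hx => harmonicAt_modal hr₀ fun i => Or.inl
      (h0 x fun h => hx (ball_subset_closedBall h))⟩

theorem hasDerivAt_radialPow (hr₀ : 0 < r₀) (j : ℤ) {r : ℝ} (hr : 0 < r) :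
    HasDerivAt (fun r : ℝ => (((r / r₀) ^ j : ℝ) : ℂ))
      (((j / r₀ * (r / r₀) ^ (j - 1) : ℝ)) : ℂ) r := by
  have h1 : HasDerivAt (fun r : ℝ => r / r₀) (1 / r₀) r := (hasDerivAt_id r).div_const r₀
  refine ((hasDerivAt_zpow j (r / r₀) (Or.inl (by positivity))).comp r h1).ofReal_comp.congr_deriv ?_
  push_cast
  ring

theorem hasDerivAt_modal (hr₀ : 0 < r₀) (θ : ℝ) {r : ℝ} (hr : 0 < r) :
    HasDerivAt (fun r : ℝ => modal r₀ k b (circleMap 0 r θ))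
      (∑ i, b i * ((k i / r₀ * (r / r₀) ^ (k i - 1) : ℝ) : ℂ) * cosMode (k i) θ) r := by
  simp only [modal_circleMap]
  exact HasDerivAt.fun_sum fun i _ =>
    ((hasDerivAt_radialPow hr₀ (k i) hr).const_mul (b i)).mul_const _

theorem iteratedDeriv_two_modal (hr₀ : 0 < r₀) (θ : ℝ) :
    iteratedDeriv 2 (fun r : ℝ => modal r₀ k b (circleMap 0 r θ)) r₀
      = ∑ i, b i * (k i * (k i - 1) / r₀ ^ 2) * cosMode (k i) θ := by
  rw [iteratedDeriv_succ, iteratedDeriv_one]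
  have h1 : deriv (fun r : ℝ => modal r₀ k b (circleMap 0 r θ)) =ᶠ[𝓝 r₀] fun r =>
      ∑ i, b i * ((k i / r₀ * (r / r₀) ^ (k i - 1) : ℝ) : ℂ) * cosMode (k i) θ := by
    filter_upwards [lt_mem_nhds hr₀] with r hr using (hasDerivAt_modal hr₀ θ hr).deriv
  rw [h1.deriv_eq]
  refine HasDerivAt.deriv (HasDerivAt.fun_sum fun i _ => ?_)
  have h2 := ((hasDerivAt_radialPow hr₀ (k i - 1) hr₀).const_mul ((k i : ℂ) / r₀)).const_mul (b i)
  have h3 := h2.mul_const (cosMode (k i) θ)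
  refine (h3.congr_deriv ?_).congr_of_eventuallyEq (Eventually.of_forall fun r => ?_)
  · rw [div_self hr₀.ne', one_zpow]
    push_cast
    ring
  · push_cast
    ring

/-- For r₀ > 0 a modal sum is smooth across the circle whatever the signs of its exponents, so the
one-sided second derivatives are ordinary ones. -/
theorem contDiffAt_modal (hr₀ : 0 < r₀) (θ : ℝ) :
    ContDiffAt ℝ 2 (fun r : ℝ => modal r₀ k b (circleMap 0 r θ)) r₀ :=
  ContDiffAt.comp r₀ (g := modal r₀ k b) (harmonicAt_modal hr₀ fun _ => Or.inl (by
    simpa using hr₀.ne')).1 (contDiff_radial θ).contDiffAt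

theorem hasDerivAt_modal_self (hr₀ : 0 < r₀) (θ : ℝ) :
    HasDerivAt (fun r : ℝ => modal r₀ k b (circleMap 0 r θ))
      (∑ i, b i * (k i / r₀) * cosMode (k i) θ) r₀ := by
  refine (hasDerivAt_modal hr₀ θ hr₀).congr_deriv (Finset.sum_congr rfl fun i _ => ?_)
  rw [div_self hr₀.ne', one_zpow]
  push_cast
  ring

theorem dνInn_modal (hr₀ : 0 < r₀) (o : ℂ → ℂ) (θ : ℝ) :
    dνInn ⟨modal r₀ k b, o⟩ r₀ θ = ∑ i, b i * (k i / r₀) * cosMode (k i) θ :=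
  (hasDerivAt_modal_self hr₀ θ).hasDerivWithinAt.derivWithin
    (uniqueDiffOn_Icc hr₀ r₀ (Set.right_mem_Icc.2 hr₀.le))

theorem dνOut_modal (hr₀ : 0 < r₀) (o : ℂ → ℂ) (θ : ℝ) :
    dνOut ⟨o, modal r₀ k b⟩ r₀ θ = ∑ i, b i * (k i / r₀) * cosMode (k i) θ :=
  (hasDerivAt_modal_self hr₀ θ).hasDerivWithinAt.derivWithin
    (uniqueDiffOn_Ici r₀ r₀ Set.self_mem_Ici)

theorem dννInn_modal (hr₀ : 0 < r₀) (o : ℂ → ℂ) (θ : ℝ) :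
    dννInn ⟨modal r₀ k b, o⟩ r₀ θ
      = ∑ i, b i * (k i * (k i - 1) / r₀ ^ 2) * cosMode (k i) θ := by
  rw [← iteratedDeriv_two_modal hr₀]
  exact iteratedDerivWithin_eq_iteratedDeriv (uniqueDiffOn_Icc hr₀) (contDiffAt_modal hr₀ θ)
    (Set.right_mem_Icc.2 hr₀.le)

theorem dννOut_modal (hr₀ : 0 < r₀) (o : ℂ → ℂ) (θ : ℝ) :
    dννOut ⟨o, modal r₀ k b⟩ r₀ θ
      = ∑ i, b i * (k i * (k i - 1) / r₀ ^ 2) * cosMode (k i) θ := by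
  rw [← iteratedDeriv_two_modal hr₀]
  exact iteratedDerivWithin_eq_iteratedDeriv (uniqueDiffOn_Ici r₀) (contDiffAt_modal hr₀ θ)
    Set.self_mem_Ici

theorem dT_modal (r θ : ℝ) : dT (modal r₀ k b) r θ
    = (r : ℂ)⁻¹ * ∑ i, b i * (((r / r₀) ^ k i : ℝ) : ℂ) * (-(k i * sinMode (k i) θ)) := by
  rw [dT]
  congr 1
  simp only [modal_circleMap]
  exact HasDerivAt.deriv (HasDerivAt.fun_sum fun i _ => (hasDerivAt_cosMode (k i) θ).const_mul _)

theorem dT_modal_self (hr₀ : 0 < r₀) (θ : ℝ) : dT (modal r₀ k b) r₀ θ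
    = -∑ i, b i * (k i / r₀) * sinMode (k i) θ := by
  rw [dT_modal, Finset.mul_sum, ← Finset.sum_neg_distrib]
  refine Finset.sum_congr rfl fun i _ => ?_
  rw [div_self hr₀.ne', one_zpow]
  push_cast
  ring

/-- The factor k - 1 arises because the tangential derivative carries 1/r: it is r⁻¹ (r/r₀)^k that
is differentiated. -/
theorem dνTInn_modal (hr₀ : 0 < r₀) (o : ℂ → ℂ) (θ : ℝ) :
    dνTInn ⟨modal r₀ k b, o⟩ r₀ θ
      = -∑ i, b i * (k i * (k i - 1) / r₀ ^ 2) * sinMode (k i) θ := by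
  have hinv : HasDerivAt (fun r : ℝ => (r : ℂ)⁻¹) (((-(r₀ ^ 2)⁻¹ : ℝ)) : ℂ) r₀ := by
    simpa only [Complex.ofReal_inv] using (hasDerivAt_inv hr₀.ne').ofReal_comp
  have h := hinv.mul (HasDerivAt.fun_sum (u := Finset.univ) fun i _ =>
    ((hasDerivAt_radialPow hr₀ (k i) hr₀).const_mul (b i)).mul_const (-(k i * sinMode (k i) θ)))
  have h2 := h.hasDerivWithinAt.derivWithin
    (uniqueDiffOn_Icc hr₀ r₀ (Set.right_mem_Icc.2 hr₀.le))
  rw [dνTInn]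
  simp only [dT_modal]
  refine h2.trans ?_
  have hr : (r₀ : ℂ) ≠ 0 := by exact_mod_cast hr₀.ne'
  rw [Finset.mul_sum, Finset.mul_sum, ← Finset.sum_add_distrib, ← Finset.sum_neg_distrib]
  refine Finset.sum_congr rfl fun i _ => ?_
  rw [div_self hr₀.ne', one_zpow, one_zpow]
  push_cast
  field_simp
  ring

/-- Vanishing amplitudes are exempted so that a constant mode which is listed but absent outside
does not spoil the decay. -/
theorem isBigO_modal (hr₀ : 0 < r₀) {p : ℕ} (h : ∀ i, b i = 0 ∨ k i ≤ -(p : ℤ)) :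
    modal r₀ k b =O[Bornology.cobounded ℂ] fun x => (‖x‖ ^ p)⁻¹ := by
  have hsum : ∀ i ∈ Finset.univ, (fun x : ℂ => b i * (((x / r₀) ^ k i).re : ℂ))
      =O[Bornology.cobounded ℂ] fun x => (‖x‖ ^ p)⁻¹ := fun i _ => ?_
  · exact IsBigO.fun_sum hsum
  rcases h i with h | h
  · simp only [h, zero_mul]
    exact isBigO_zero _ _
  · refine IsBigO.of_bound (‖b i‖ * r₀ ^ p) ?_
    have hev : ∀ᶠ x : ℂ in Bornology.cobounded ℂ, r₀ ≤ ‖x‖ :=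
      tendsto_norm_cobounded_atTop.eventually_ge_atTop r₀
    filter_upwards [hev] with x hx
    have hx0 : 0 < ‖x‖ := hr₀.trans_le hx
    rw [norm_mul, Complex.norm_real, norm_inv, norm_pow, norm_norm, mul_assoc]
    refine mul_le_mul_of_nonneg_left ?_ (norm_nonneg _)
    refine (Complex.abs_re_le_norm _).trans ?_
    rw [norm_zpow, norm_div, Complex.norm_real, Real.norm_eq_abs, abs_of_pos hr₀]
    calc (‖x‖ / r₀) ^ k i ≤ (‖x‖ / r₀) ^ (-(p : ℤ)) :=
          zpow_le_zpow_right₀ ((one_le_div hr₀).2 hx) h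
      _ = r₀ ^ p * (‖x‖ ^ p)⁻¹ := by
          rw [zpow_neg, zpow_natCast, div_pow, inv_div, div_eq_mul_inv]

/-! ### The transmission problem for finitely many modes -/

/-- The outer amplitude of the mode `k` for the jumps `g` and `h` of the trace and of the flux. -/
noncomputable def outAmplitude (r₀ : ℝ) (eps : ℂ) (k : ℤ) (g h : ℂ) : ℂ :=
  if k = 0 then 0 else (eps * g - h * r₀ / k) / (1 + eps)

/-- The potential with jumps `∑ᵢ gᵢ cos(kᵢ θ)` of the trace and `∑ᵢ hᵢ cos(kᵢ θ)` of the flux. -/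
noncomputable def modalSolution (r₀ : ℝ) (eps : ℂ) (k : Fin m → ℤ) (g h : Fin m → ℂ) : Potential where
  inn := modal r₀ k fun i => outAmplitude r₀ eps (k i) (g i) (h i) - g i
  out := modal r₀ (fun i => -k i) fun i => outAmplitude r₀ eps (k i) (g i) (h i)

variable {eps : ℂ} {g h : Fin m → ℂ}

theorem isHarmonic_modalSolution (hr₀ : 0 < r₀) (hk : ∀ i, 0 ≤ k i) :
    (modalSolution r₀ eps k g h).IsHarmonic r₀ := isHarmonic_modal hr₀ hk

theorem trace_modalSolution (hr₀ : 0 < r₀) (θ : ℝ) :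
    (modalSolution r₀ eps k g h).out (circleMap 0 r₀ θ)
      - (modalSolution r₀ eps k g h).inn (circleMap 0 r₀ θ) = ∑ i, g i * cosMode (k i) θ := by
  simp only [modalSolution, modal_circleMap_self hr₀, cosMode_neg, ← Finset.sum_sub_distrib]
  exact Finset.sum_congr rfl fun i _ => by ring

/-- With outer amplitude a and inner amplitude a - g, the mode k contributes the flux jump -(k/r₀)(a
+ ε(a - g)); solving for a gives `outAmplitude`. A constant mode has no flux, which forces h = 0
there. -/
theorem flux_modalSolution (hr₀ : 0 < r₀) (heps : eps ≠ -1) (hh : ∀ i, k i = 0 → h i = 0)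
    (θ : ℝ) :
    dνOut (modalSolution r₀ eps k g h) r₀ θ - eps * dνInn (modalSolution r₀ eps k g h) r₀ θ
      = ∑ i, h i * cosMode (k i) θ := by
  simp only [modalSolution, dνOut_modal hr₀, dνInn_modal hr₀, cosMode_neg, Finset.mul_sum,
    ← Finset.sum_sub_distrib]
  refine Finset.sum_congr rfl fun i _ => ?_
  have hr : (r₀ : ℂ) ≠ 0 := by exact_mod_cast hr₀.ne'
  have he : 1 + eps ≠ 0 := fun h => heps (by linear_combination h)
  rw [outAmplitude]
  split_ifs with hki
  · simp [hki, hh i hki]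
  · have hk' : (k i : ℂ) ≠ 0 := by exact_mod_cast hki
    push_cast
    field_simp
    ring

theorem isBigO_modalSolution (hr₀ : 0 < r₀) {p : ℕ} (hk : ∀ i, k i = 0 ∨ (p : ℤ) ≤ k i) :
    (modalSolution r₀ eps k g h).out =O[Bornology.cobounded ℂ] fun x => (‖x‖ ^ p)⁻¹ := by
  refine isBigO_modal hr₀ fun i => ?_
  rcases hk i with h | h
  · left; simp [outAmplitude, h]
  · right; linarith

end

section

/-! ### The explicit expansion -/

section Explicit

variable (μ : Medium) (E r₀ : ℝ) (ℓ n : ℕ)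

/-- The amplitude of the interior normal derivative of the leading-order linear potential. -/
noncomputable def slope : ℂ := -2 * E * r₀ ^ ℓ / (1 + μ.epsω) * ℓ / r₀

/-- The leading-order linear potential. -/
noncomputable def linear0 : Potential where
  inn := modal r₀ ![(ℓ : ℤ)] ![-2 * E * r₀ ^ ℓ / (1 + μ.epsω)]
  out := modal r₀ ![(ℓ : ℤ), -ℓ]
    ![-E * r₀ ^ ℓ, -E * r₀ ^ ℓ * (1 - μ.epsω) / (1 + μ.epsω)]

/-- The jump amplitude `2π χ_⊥ ε_ω² p²` of the leading-order second-harmonic potential, where `p` is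
the slope of the linear potential. -/
noncomputable def jump0 : ℂ := 2 * Real.pi * μ.χperp * μ.epsω ^ 2 * slope μ E r₀ ℓ ^ 2

/-- The product `χ_∥ ε_ω p²`, where `p` is the slope of the linear potential. -/
noncomputable def shear0 : ℂ := μ.χpar * μ.epsω * slope μ E r₀ ℓ ^ 2

/-- The leading-order second-harmonic potential. -/
noncomputable def second0 : Potential :=
  modalSolution r₀ μ.eps2ω ![0, 2 * (ℓ : ℤ)] ![jump0 μ E r₀ ℓ, jump0 μ E r₀ ℓ]
    ![0, -8 * Real.pi * ℓ * shear0 μ E r₀ ℓ / r₀]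

/-- The outer amplitude of the leading-order second-harmonic potential. -/
noncomputable def second0Amp : ℂ :=
  (μ.eps2ω * jump0 μ E r₀ ℓ + 4 * Real.pi * shear0 μ E r₀ ℓ) / (1 + μ.eps2ω)

/-- The first-order linear potential. -/
noncomputable def linear1 : Potential :=
  modalSolution r₀ μ.epsω ![(n : ℤ) - ℓ, n + ℓ]
    ![r₀ * (1 - μ.epsω) * slope μ E r₀ ℓ / 2, r₀ * (1 - μ.epsω) * slope μ E r₀ ℓ / 2]
    ![(1 - μ.epsω) * slope μ E r₀ ℓ / 2 * (n - ℓ), -((1 - μ.epsω) * slope μ E r₀ ℓ / 2 * (n + ℓ))]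

/-- The reflection coefficient `(1 - ε_ω) / (1 + ε_ω)`. -/
noncomputable def contrast : ℂ := (1 - μ.epsω) / (1 + μ.epsω)

/-- The trace jumps of the modes `n - 2ℓ`, `n`, `n + 2ℓ` of the first-order second-harmonic
potential. -/
noncomputable def traceJump1 : Fin 3 → ℂ :=
  ![ℓ * (2 * second0Amp μ E r₀ ℓ - jump0 μ E r₀ ℓ)
      + jump0 μ E r₀ ℓ * (-2 * contrast μ * (n - ℓ) + (ℓ - 1) - n),
    jump0 μ E r₀ ℓ * (-2 * contrast μ * (n - ℓ) + 2 * (ℓ - 1)),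
    ℓ * (2 * second0Amp μ E r₀ ℓ - jump0 μ E r₀ ℓ)
      + jump0 μ E r₀ ℓ * ((ℓ - 1) + n)]

/-- The flux jumps, multiplied by `r₀`, of the modes `n - 2ℓ`, `n`, `n + 2ℓ` of the first-order
second-harmonic potential. -/
noncomputable def fluxJumpAmp1 : Fin 3 → ℂ :=
  ![ℓ * (μ.eps2ω * (2 * ℓ - 1) * (second0Amp μ E r₀ ℓ - jump0 μ E r₀ ℓ)
        - (2 * ℓ + 1) * second0Amp μ E r₀ ℓ
        + n * (second0Amp μ E r₀ ℓ - μ.eps2ω * (second0Amp μ E r₀ ℓ - jump0 μ E r₀ ℓ)))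
      + 4 * Real.pi * shear0 μ E r₀ ℓ * (ℓ + (ℓ - 1 - n) * (n - 2 * ℓ)),
    8 * Real.pi * shear0 μ E r₀ ℓ * contrast μ * (n - ℓ) * n,
    ℓ * (μ.eps2ω * (2 * ℓ - 1) * (second0Amp μ E r₀ ℓ - jump0 μ E r₀ ℓ)
        - (2 * ℓ + 1) * second0Amp μ E r₀ ℓ
        - n * (second0Amp μ E r₀ ℓ - μ.eps2ω * (second0Amp μ E r₀ ℓ - jump0 μ E r₀ ℓ)))
      + 4 * Real.pi * shear0 μ E r₀ ℓ * (ℓ - (ℓ - 1 + n) * (n + 2 * ℓ))]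

/-- The first-order second-harmonic potential. -/
noncomputable def second1 : Potential :=
  modalSolution r₀ μ.eps2ω ![|(n : ℤ) - 2 * ℓ|, n, n + 2 * ℓ] (traceJump1 μ E r₀ ℓ n)
    fun i => fluxJumpAmp1 μ E r₀ ℓ n i / r₀

end Explicit

variable {μ : Medium} {E r₀ : ℝ} {ℓ n : ℕ}

/-! ### Verification of the leading-order system. -/

theorem background_eq_modal (hr₀ : 0 < r₀) :
    background E ℓ = modal r₀ ![(ℓ : ℤ)] ![-E * r₀ ^ ℓ] := by
  funext x
  have hr : (r₀ : ℂ) ≠ 0 := by exact_mod_cast hr₀.ne'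
  conv_rhs => rw [← circleMap_norm_arg x, modal_circleMap]
  simp only [Finset.univ_unique, Fin.default_eq_zero, Matrix.cons_val_zero, Finset.sum_singleton,
    zpow_natCast, cosMode, background, Int.cast_natCast]
  push_cast
  rw [div_pow]
  field_simp

theorem one_add_ne_zero_of_ne {z : ℂ} (hz : z ≠ -1) : 1 + z ≠ 0 := fun h =>
  hz (by linear_combination h)

theorem dνInn_linear0 (hr₀ : 0 < r₀) (θ : ℝ) :
    dνInn (linear0 μ E r₀ ℓ) r₀ θ = slope μ E r₀ ℓ * cosMode ℓ θ := by
  simp only [linear0, dνInn_modal hr₀]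
  simp [slope, mul_div_assoc]

theorem dT_linear0 (hr₀ : 0 < r₀) (θ : ℝ) :
    dT (linear0 μ E r₀ ℓ).inn r₀ θ = -(slope μ E r₀ ℓ * sinMode ℓ θ) := by
  simp only [linear0, dT_modal_self hr₀]
  simp [slope, mul_div_assoc]

theorem dT_out_linear0 (hr₀ : 0 < r₀) (he : μ.epsω ≠ -1) (θ : ℝ) :
    dT (linear0 μ E r₀ ℓ).out r₀ θ = -(slope μ E r₀ ℓ * sinMode ℓ θ) := by
  have he' := one_add_ne_zero_of_ne he
  have hr : (r₀ : ℂ) ≠ 0 := by exact_mod_cast hr₀.ne'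
  simp only [linear0, dT_modal_self hr₀]
  simp [slope, Fin.sum_univ_two, sinMode_neg]
  field_simp
  ring

theorem dνOut_linear0 (hr₀ : 0 < r₀) (he : μ.epsω ≠ -1) (θ : ℝ) :
    dνOut (linear0 μ E r₀ ℓ) r₀ θ = μ.epsω * (slope μ E r₀ ℓ * cosMode ℓ θ) := by
  have he' := one_add_ne_zero_of_ne he
  have hr : (r₀ : ℂ) ≠ 0 := by exact_mod_cast hr₀.ne'
  simp only [linear0, dνOut_modal hr₀]
  simp [slope, Fin.sum_univ_two, cosMode_neg]
  field_simp
  ring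

theorem dννInn_linear0 (hr₀ : 0 < r₀) (θ : ℝ) :
    dννInn (linear0 μ E r₀ ℓ) r₀ θ = slope μ E r₀ ℓ * (ℓ - 1) / r₀ * cosMode ℓ θ := by
  simp only [linear0, dννInn_modal hr₀]
  simp [slope]
  left
  ring

theorem dννOut_linear0 (hr₀ : 0 < r₀) (he : μ.epsω ≠ -1) (θ : ℝ) :
    dννOut (linear0 μ E r₀ ℓ) r₀ θ = slope μ E r₀ ℓ * (ℓ - μ.epsω) / r₀ * cosMode ℓ θ := by
  have he' := one_add_ne_zero_of_ne he
  have hr : (r₀ : ℂ) ≠ 0 := by exact_mod_cast hr₀.ne'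
  simp only [linear0, dννOut_modal hr₀]
  simp [slope, Fin.sum_univ_two, cosMode_neg]
  field_simp
  ring

theorem dνTInn_linear0 (hr₀ : 0 < r₀) (θ : ℝ) :
    dνTInn (linear0 μ E r₀ ℓ) r₀ θ = -(slope μ E r₀ ℓ * (ℓ - 1) / r₀ * sinMode ℓ θ) := by
  simp only [linear0, dνTInn_modal hr₀]
  simp [slope]
  left
  ring

theorem Pperp0_linear0 (hr₀ : 0 < r₀) (θ : ℝ) :
    4 * Real.pi * Pperp0 μ r₀ (linear0 μ E r₀ ℓ) θ
      = jump0 μ E r₀ ℓ * (1 + cosMode (2 * ℓ) θ) := by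
  rw [Pperp0, dνInn_linear0 hr₀, jump0, two_mul (ℓ : ℤ), cosMode_add]
  linear_combination (2 * Real.pi * μ.χperp * μ.epsω ^ 2 * slope μ E r₀ ℓ ^ 2) *
    sinMode_sq_add_cosMode_sq ℓ θ

theorem Ppar0_linear0 (hr₀ : 0 < r₀) :
    Ppar0 μ r₀ (linear0 μ E r₀ ℓ) = fun θ => -shear0 μ E r₀ ℓ * sinMode (2 * ℓ) θ := by
  funext θ
  rw [Ppar0, dνInn_linear0 hr₀, dT_linear0 hr₀, shear0, two_mul (ℓ : ℤ), sinMode_add]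
  ring

theorem deriv_Ppar0_linear0 (hr₀ : 0 < r₀) (θ : ℝ) :
    deriv (Ppar0 μ r₀ (linear0 μ E r₀ ℓ)) θ
      = -2 * ℓ * shear0 μ E r₀ ℓ * cosMode (2 * ℓ) θ := by
  rw [Ppar0_linear0 hr₀, ((hasDerivAt_sinMode (2 * ℓ) θ).const_mul _).deriv]
  push_cast
  ring

theorem isLeadingOrder_explicit (hr₀ : 0 < r₀) (hℓ : 2 ≤ ℓ) (he : μ.epsω ≠ -1)
    (hd : μ.eps2ω ≠ -1) :
    IsLeadingOrder μ r₀ (background E ℓ) (linear0 μ E r₀ ℓ) (second0 μ E r₀ ℓ) where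
  harmonic_u := isHarmonic_modal hr₀ (by simp)
  trace_u θ := by
    have he' := one_add_ne_zero_of_ne he
    simp only [linear0, modal_circleMap_self hr₀]
    simp [Fin.sum_univ_two, cosMode_neg]
    field_simp
    ring
  flux_u θ := by rw [dνOut_linear0 hr₀ he, dνInn_linear0 hr₀]
  decay_u := by
    have h : (fun x => (linear0 μ E r₀ ℓ).out x - background E ℓ x)
        = modal r₀ ![-(ℓ : ℤ)] ![-E * r₀ ^ ℓ * (1 - μ.epsω) / (1 + μ.epsω)] := by
      funext x
      rw [background_eq_modal hr₀]
      simp [linear0, modal, Fin.sum_univ_two]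
    rw [h]
    have h2 := isBigO_modal (k := ![-(ℓ : ℤ)]) (p := 1)
      (b := ![-E * r₀ ^ ℓ * (1 - μ.epsω) / (1 + μ.epsω)]) hr₀
      (fun i => Or.inr (by fin_cases i; simp; omega))
    simpa using h2
  harmonic_v := isHarmonic_modalSolution hr₀ (by simp [Fin.forall_fin_two])
  trace_v θ := by
    rw [second0, trace_modalSolution hr₀, Pperp0_linear0 hr₀]
    simp [Fin.sum_univ_two, cosMode_zero]
    ring
  flux_v θ := by
    have hℓ0 : ℓ ≠ 0 := by omega
    rw [second0, flux_modalSolution hr₀ hd (by simp [Fin.forall_fin_two, hℓ0]), sigma0,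
      deriv_Ppar0_linear0 hr₀]
    simp [Fin.sum_univ_two]
    ring
  decay_v := isBigO_modalSolution hr₀ (by simp [Fin.forall_fin_two]; omega)

/-- The mean of the trace jump is absorbed by the constant -`jump0` inside, since a constant outside
would violate the decay. The pole of `second0Amp` at ε_{2ω} = -1 is the origin of the double
resonance at 2ω. -/
theorem second0_eq (hr₀ : 0 < r₀) (hℓ : 2 ≤ ℓ) : second0 μ E r₀ ℓ =
    ⟨modal r₀ ![0, 2 * (ℓ : ℤ)] ![-jump0 μ E r₀ ℓ, second0Amp μ E r₀ ℓ - jump0 μ E r₀ ℓ],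
      modal r₀ ![0, -(2 * (ℓ : ℤ))] ![0, second0Amp μ E r₀ ℓ]⟩ := by
  have hr : (r₀ : ℂ) ≠ 0 := by exact_mod_cast hr₀.ne'
  have hℓ0 : ℓ ≠ 0 := by omega
  have hℓ1 : (ℓ : ℂ) ≠ 0 := by exact_mod_cast hℓ0
  have hamp : outAmplitude r₀ μ.eps2ω (2 * (ℓ : ℤ)) (jump0 μ E r₀ ℓ)
      (-8 * Real.pi * ℓ * shear0 μ E r₀ ℓ / r₀) = second0Amp μ E r₀ ℓ := by
    rw [outAmplitude, if_neg (by omega), second0Amp]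
    congr 1
    push_cast
    field_simp
    ring
  have hamp0 : ∀ g h : ℂ, outAmplitude r₀ μ.eps2ω 0 g h = 0 := fun g h => if_pos rfl
  rw [second0, modalSolution]
  congr 2
  · funext i; fin_cases i <;> simp [hamp0, ← hamp]
  · funext i; fin_cases i <;> simp
  · funext i; fin_cases i <;> simp [hamp0, ← hamp]

/-- The inner amplitude of a mode k is -(g + h r₀/k)/(1 + ε_ω). For k = n + ℓ one has h r₀/k = -g,
so this mode is absent inside; for k = n - ℓ one has h r₀/k = g. Hence the extra pole at ω enters
the nonlinear sources through n - ℓ alone. -/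
theorem linear1_inn_eq (hr₀ : 0 < r₀) (hn : ℓ < n) (he : μ.epsω ≠ -1) :
    (linear1 μ E r₀ ℓ n).inn = modal r₀ ![(n : ℤ) - ℓ, n + ℓ]
      ![-r₀ * slope μ E r₀ ℓ * contrast μ, 0] := by
  have hr : (r₀ : ℂ) ≠ 0 := by exact_mod_cast hr₀.ne'
  have he' := one_add_ne_zero_of_ne he
  have h1 : (n : ℂ) - ℓ ≠ 0 := sub_ne_zero.2 (by exact_mod_cast hn.ne')
  have h2 : (n : ℂ) + ℓ ≠ 0 := by exact_mod_cast (by omega : n + ℓ ≠ 0)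
  have k1 : ∀ g h, outAmplitude r₀ μ.epsω (n - ℓ) g h
      = (μ.epsω * g - h * r₀ / (n - ℓ)) / (1 + μ.epsω) := fun g h => by
    rw [outAmplitude, if_neg (by omega)]
    push_cast
    rfl
  have k2 : ∀ g h, outAmplitude r₀ μ.epsω (n + ℓ) g h
      = (μ.epsω * g - h * r₀ / (n + ℓ)) / (1 + μ.epsω) := fun g h => by
    rw [outAmplitude, if_neg (by omega)]
    push_cast
    rfl
  rw [linear1, modalSolution]
  refine congrArg (modal r₀ _) (funext fun i => ?_)
  fin_cases i
  · simp [k1, contrast]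
    field_simp
    ring
  · simp [k2]
    field_simp
    ring

theorem dνInn_linear1 (hr₀ : 0 < r₀) (hn : ℓ < n) (he : μ.epsω ≠ -1) (θ : ℝ) :
    dνInn (linear1 μ E r₀ ℓ n) r₀ θ
      = -(slope μ E r₀ ℓ * contrast μ * (n - ℓ) * cosMode (n - ℓ) θ) := by
  have hr : (r₀ : ℂ) ≠ 0 := by exact_mod_cast hr₀.ne'
  have := dνInn_modal (k := ![(n : ℤ) - ℓ, n + ℓ])
    (b := ![-r₀ * slope μ E r₀ ℓ * contrast μ, 0]) hr₀ (linear1 μ E r₀ ℓ n).out θ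
  rw [← linear1_inn_eq hr₀ hn he] at this
  rw [this]
  simp [Fin.sum_univ_two]
  left
  field_simp

theorem dT_linear1 (hr₀ : 0 < r₀) (hn : ℓ < n) (he : μ.epsω ≠ -1) (θ : ℝ) :
    dT (linear1 μ E r₀ ℓ n).inn r₀ θ
      = slope μ E r₀ ℓ * contrast μ * (n - ℓ) * sinMode (n - ℓ) θ := by
  have hr : (r₀ : ℂ) ≠ 0 := by exact_mod_cast hr₀.ne'
  rw [linear1_inn_eq hr₀ hn he, dT_modal_self hr₀]
  simp [Fin.sum_univ_two]
  left
  field_simp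

/-! ### The first-order sources. -/

theorem perturbation_eq (θ : ℝ) : ((perturbation r₀ n θ : ℝ) : ℂ) = r₀ * cosMode n θ := by
  simp [perturbation, cosMode]

theorem fT_perturbation (hr₀ : 0 < r₀) (θ : ℝ) :
    fT r₀ (perturbation r₀ n) θ = -(n * sinMode n θ) := by
  have h : HasDerivAt (perturbation r₀ n) (r₀ * (-Real.sin (n * θ) * n)) θ := by
    have h1 : HasDerivAt (fun φ : ℝ => (n : ℝ) * φ) n θ := by
      simpa using (hasDerivAt_id θ).const_mul (n : ℝ)
    exact h1.cos.const_mul r₀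
  have hr : (r₀ : ℂ) ≠ 0 := by exact_mod_cast hr₀.ne'
  rw [fT, h.deriv, sinMode]
  push_cast
  field_simp

theorem normal1_explicit (hr₀ : 0 < r₀) (hn : ℓ < n) (he : μ.epsω ≠ -1) (θ : ℝ) :
    normal1 r₀ (perturbation r₀ n) (linear0 μ E r₀ ℓ) (linear1 μ E r₀ ℓ n) θ
      = slope μ E r₀ ℓ * (-(contrast μ * (n - ℓ) * cosMode (n - ℓ) θ)
        + (ℓ - 1) * cosMode n θ * cosMode ℓ θ - n * sinMode n θ * sinMode ℓ θ) := by
  have hr : (r₀ : ℂ) ≠ 0 := by exact_mod_cast hr₀.ne'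
  rw [normal1, dνInn_linear1 hr₀ hn he, dννInn_linear0 hr₀, fT_perturbation hr₀, dT_linear0 hr₀,
    perturbation_eq]
  field_simp

theorem tangential1_explicit (hr₀ : 0 < r₀) (hn : ℓ < n) (he : μ.epsω ≠ -1) (θ : ℝ) :
    tangential1 r₀ (perturbation r₀ n) (linear0 μ E r₀ ℓ) (linear1 μ E r₀ ℓ n) θ
      = slope μ E r₀ ℓ * (contrast μ * (n - ℓ) * sinMode (n - ℓ) θ
        - (ℓ - 1) * cosMode n θ * sinMode ℓ θ - n * sinMode n θ * cosMode ℓ θ) := by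
  have hr : (r₀ : ℂ) ≠ 0 := by exact_mod_cast hr₀.ne'
  rw [tangential1, dT_linear1 hr₀ hn he, dνTInn_linear0 hr₀, fT_perturbation hr₀,
    dνInn_linear0 hr₀, perturbation_eq]
  field_simp
  ring

/-- Expansion of the modes `n ± 2ℓ` in the modes `n` and `ℓ`. -/
theorem cosMode_sub_two_mul (n ℓ : ℤ) (θ : ℝ) : cosMode (n - 2 * ℓ) θ
    = cosMode n θ * (cosMode ℓ θ ^ 2 - sinMode ℓ θ ^ 2)
      + sinMode n θ * (2 * sinMode ℓ θ * cosMode ℓ θ) := by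
  rw [cosMode_sub, two_mul, cosMode_add, sinMode_add]; ring

theorem cosMode_add_two_mul (n ℓ : ℤ) (θ : ℝ) : cosMode (n + 2 * ℓ) θ
    = cosMode n θ * (cosMode ℓ θ ^ 2 - sinMode ℓ θ ^ 2)
      - sinMode n θ * (2 * sinMode ℓ θ * cosMode ℓ θ) := by
  rw [cosMode_add, two_mul, cosMode_add, sinMode_add]; ring

theorem sinMode_sub_two_mul (n ℓ : ℤ) (θ : ℝ) : sinMode (n - 2 * ℓ) θ
    = sinMode n θ * (cosMode ℓ θ ^ 2 - sinMode ℓ θ ^ 2)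
      - cosMode n θ * (2 * sinMode ℓ θ * cosMode ℓ θ) := by
  rw [sinMode_sub, two_mul, cosMode_add, sinMode_add]; ring

theorem sinMode_add_two_mul (n ℓ : ℤ) (θ : ℝ) : sinMode (n + 2 * ℓ) θ
    = sinMode n θ * (cosMode ℓ θ ^ 2 - sinMode ℓ θ ^ 2)
      + cosMode n θ * (2 * sinMode ℓ θ * cosMode ℓ θ) := by
  rw [sinMode_add, two_mul, cosMode_add, sinMode_add]; ring

/-- Once all modes are polynomials in the sines and cosines of nθ and ℓθ, the two sides differ by a
multiple of sin²(ℓθ) + cos²(ℓθ) - 1. -/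
theorem Pperp1_explicit (hr₀ : 0 < r₀) (hn : ℓ < n) (he : μ.epsω ≠ -1) (θ : ℝ) :
    4 * Real.pi * Pperp1 μ r₀ (perturbation r₀ n) (linear0 μ E r₀ ℓ) (linear1 μ E r₀ ℓ n) θ
      = jump0 μ E r₀ ℓ * ((-2 * contrast μ * (n - ℓ) + (ℓ - 1) - n) * cosMode (n - 2 * ℓ) θ
        + (-2 * contrast μ * (n - ℓ) + 2 * (ℓ - 1)) * cosMode n θ
        + ((ℓ - 1) + n) * cosMode (n + 2 * ℓ) θ) := by
  rw [Pperp1, normal1_explicit hr₀ hn he, dνInn_linear0 hr₀, jump0, cosMode_sub_two_mul,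
    cosMode_add_two_mul, cosMode_sub]
  have h := sinMode_sq_add_cosMode_sq ℓ θ
  linear_combination (2 * Real.pi * μ.χperp * μ.epsω ^ 2 * slope μ E r₀ ℓ ^ 2 * cosMode n θ)
    * (-2 * contrast μ * (n - ℓ) + 2 * (ℓ - 1)) * h

theorem Ppar1_explicit (hr₀ : 0 < r₀) (hn : ℓ < n) (he : μ.epsω ≠ -1) :
    Ppar1 μ r₀ (perturbation r₀ n) (linear0 μ E r₀ ℓ) (linear1 μ E r₀ ℓ n)
      = fun θ => 2 * shear0 μ E r₀ ℓ * contrast μ * (n - ℓ) * sinMode n θ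
        + (shear0 μ E r₀ ℓ * (ℓ - 1 - n) * sinMode (n - 2 * ℓ) θ
          + -shear0 μ E r₀ ℓ * (ℓ - 1 + n) * sinMode (n + 2 * ℓ) θ) := by
  funext θ
  rw [Ppar1, normal1_explicit hr₀ hn he, tangential1_explicit hr₀ hn he, dνInn_linear0 hr₀,
    dT_linear0 hr₀, shear0, sinMode_sub_two_mul, sinMode_add_two_mul, cosMode_sub, sinMode_sub]
  have h := sinMode_sq_add_cosMode_sq ℓ θ
  linear_combination (2 * μ.χpar * μ.epsω * slope μ E r₀ ℓ ^ 2 * contrast μ * (n - ℓ)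
    * sinMode n θ) * h

/-- The isolated summands ℓ come from the correction of the Lamé coefficient, f/r₀² times the
derivative of P_∥ at leading order; the rest is the derivative of P_∥ at first order. -/
theorem sigma1_explicit (hr₀ : 0 < r₀) (hn : ℓ < n) (he : μ.epsω ≠ -1) (θ : ℝ) :
    4 * Real.pi * sigma1 μ r₀ (perturbation r₀ n) (linear0 μ E r₀ ℓ) (linear1 μ E r₀ ℓ n) θ
      = -(4 * Real.pi * shear0 μ E r₀ ℓ / r₀)
        * ((ℓ + (ℓ - 1 - n) * (n - 2 * ℓ)) * cosMode (n - 2 * ℓ) θ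
          + 2 * contrast μ * (n - ℓ) * n * cosMode n θ
          + (ℓ - (ℓ - 1 + n) * (n + 2 * ℓ)) * cosMode (n + 2 * ℓ) θ) := by
  have hr : (r₀ : ℂ) ≠ 0 := by exact_mod_cast hr₀.ne'
  rw [sigma1, deriv_Ppar0_linear0 hr₀, Ppar1_explicit hr₀ hn he,
    (((hasDerivAt_sinMode n θ).const_mul _).fun_add
      (((hasDerivAt_sinMode (n - 2 * ℓ) θ).const_mul _).fun_add
        ((hasDerivAt_sinMode (n + 2 * ℓ) θ).const_mul _))).deriv, perturbation_eq,
    cosMode_sub n (2 * ℓ), cosMode_add n (2 * ℓ)]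
  push_cast
  field_simp
  ring

/-- The constant mode of v₀ has no normal derivative, so only the products of cos(nθ) and cos(2ℓθ)
occur. The mode n therefore receives nothing from v₀ and has a simple pole at 2ω. -/
theorem jump1_second0 (hr₀ : 0 < r₀) (hℓ : 2 ≤ ℓ) (θ : ℝ) :
    jump1 r₀ (perturbation r₀ n) (second0 μ E r₀ ℓ) θ
      = ℓ * (2 * second0Amp μ E r₀ ℓ - jump0 μ E r₀ ℓ)
        * (cosMode (n - 2 * ℓ) θ + cosMode (n + 2 * ℓ) θ) := by
  have hr : (r₀ : ℂ) ≠ 0 := by exact_mod_cast hr₀.ne'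
  rw [jump1, second0_eq hr₀ hℓ, dνInn_modal hr₀, dνOut_modal hr₀, perturbation_eq,
    cosMode_sub n (2 * ℓ), cosMode_add n (2 * ℓ)]
  simp [Fin.sum_univ_two, cosMode_neg]
  field_simp
  ring

theorem fluxJump1_second0 (hr₀ : 0 < r₀) (hℓ : 2 ≤ ℓ) (θ : ℝ) :
    fluxJump1 μ.eps2ω r₀ (perturbation r₀ n) (second0 μ E r₀ ℓ) θ
      = ℓ / r₀ * ((μ.eps2ω * (2 * ℓ - 1) * (second0Amp μ E r₀ ℓ - jump0 μ E r₀ ℓ)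
            - (2 * ℓ + 1) * second0Amp μ E r₀ ℓ)
          * (cosMode (n - 2 * ℓ) θ + cosMode (n + 2 * ℓ) θ)
        + n * (second0Amp μ E r₀ ℓ - μ.eps2ω * (second0Amp μ E r₀ ℓ - jump0 μ E r₀ ℓ))
          * (cosMode (n - 2 * ℓ) θ - cosMode (n + 2 * ℓ) θ)) := by
  have hr : (r₀ : ℂ) ≠ 0 := by exact_mod_cast hr₀.ne'
  rw [fluxJump1, second0_eq hr₀ hℓ, dννInn_modal hr₀, dννOut_modal hr₀, dT_modal_self hr₀,
    dT_modal_self hr₀, perturbation_eq, fT_perturbation hr₀, cosMode_sub n (2 * ℓ),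
    cosMode_add n (2 * ℓ)]
  simp [Fin.sum_univ_two, cosMode_neg, sinMode_neg]
  field_simp
  ring

theorem isFirstOrder_explicit (hr₀ : 0 < r₀) (hℓ : 2 ≤ ℓ) (hn : ℓ < n) (hn2 : n ≠ 2 * ℓ)
    (he : μ.epsω ≠ -1) (hd : μ.eps2ω ≠ -1) :
    IsFirstOrder μ r₀ (perturbation r₀ n) (linear0 μ E r₀ ℓ) (second0 μ E r₀ ℓ)
      (linear1 μ E r₀ ℓ n) (second1 μ E r₀ ℓ n) where
  harmonic_u := isHarmonic_modalSolution hr₀ (by simp [Fin.forall_fin_two]; omega)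
  trace_u θ := by
    have hr : (r₀ : ℂ) ≠ 0 := by exact_mod_cast hr₀.ne'
    rw [linear1, trace_modalSolution hr₀, jump1, dνInn_linear0 hr₀, dνOut_linear0 hr₀ he,
      perturbation_eq]
    simp [Fin.sum_univ_two, cosMode_sub, cosMode_add]
    ring
  flux_u θ := by
    have hr : (r₀ : ℂ) ≠ 0 := by exact_mod_cast hr₀.ne'
    rw [linear1, flux_modalSolution hr₀ he (by simp [Fin.forall_fin_two]; omega), fluxJump1,
      dννInn_linear0 hr₀, dννOut_linear0 hr₀ he, dT_out_linear0 hr₀ he, dT_linear0 hr₀,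
      perturbation_eq, fT_perturbation hr₀]
    simp [Fin.sum_univ_two, cosMode_sub, cosMode_add]
    field_simp
    ring
  decay_u := by
    have h := isBigO_modalSolution (k := ![(n : ℤ) - ℓ, n + ℓ]) (eps := μ.epsω) (p := 1)
      (g := ![r₀ * (1 - μ.epsω) * slope μ E r₀ ℓ / 2, r₀ * (1 - μ.epsω) * slope μ E r₀ ℓ / 2])
      (h := ![(1 - μ.epsω) * slope μ E r₀ ℓ / 2 * (n - ℓ),
        -((1 - μ.epsω) * slope μ E r₀ ℓ / 2 * (n + ℓ))]) hr₀
      (by simp [Fin.forall_fin_two]; omega)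
    simpa [linear1] using h
  harmonic_v := isHarmonic_modalSolution hr₀ (by simp [Fin.forall_fin_succ]; omega)
  trace_v θ := by
    rw [second1, trace_modalSolution hr₀, jump1_second0 hr₀ hℓ, Pperp1_explicit hr₀ hn he]
    simp [Fin.sum_univ_three, cosMode_abs, traceJump1]
    ring
  flux_v θ := by
    -- Since n ≠ 2ℓ, none of the three frequencies is zero, and the condition on the mean flux is
    -- vacuous.
    rw [second1, flux_modalSolution hr₀ hd (by simp [Fin.forall_fin_succ]; omega),
      fluxJump1_second0 hr₀ hℓ, sigma1_explicit hr₀ hn he]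
    simp [Fin.sum_univ_three, cosMode_abs, fluxJumpAmp1]
    ring
  decay_v := by
    refine (isBigO_modalSolution (p := 1) hr₀ ?_).trans_tendsto
      (tendsto_inv_norm_pow_cobounded one_ne_zero)
    have h := Int.one_le_abs (show (n : ℤ) - 2 * ℓ ≠ 0 by omega)
    simp [Fin.forall_fin_succ]
    omega

theorem isExpansion_explicit (hr₀ : 0 < r₀) (hℓ : 2 ≤ ℓ) (hn : ℓ < n) (hn2 : n ≠ 2 * ℓ)
    (he : μ.epsω ≠ -1) (hd : μ.eps2ω ≠ -1) :
    IsExpansion μ E r₀ ℓ n (linear0 μ E r₀ ℓ) (second0 μ E r₀ ℓ) (linear1 μ E r₀ ℓ n)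
      (second1 μ E r₀ ℓ n) :=
  ⟨isLeadingOrder_explicit hr₀ hℓ he hd, isFirstOrder_explicit hr₀ hℓ hn hn2 he hd⟩

end

section

/-! ### Mode amplitudes of the first-order second-harmonic potential -/

variable {μ : Medium} {E r₀ : ℝ} {ℓ n : ℕ}

theorem natCast_relDegree (ℓ n : ℕ) : ((relDegree ℓ n : ℕ) : ℤ) = |(n : ℤ) - 2 * ℓ| :=
  Int.natCast_natAbs _

theorem prefactor_eq (hr₀ : 0 < r₀) (hℓ : 2 ≤ ℓ) :
    prefactor μ E r₀ ℓ = 2 * Real.pi * slope μ E r₀ ℓ ^ 2 / (1 + μ.eps2ω) := by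
  have hr : (r₀ : ℂ) ≠ 0 := by exact_mod_cast hr₀.ne'
  -- This removes the truncated subtraction in the exponent 2ℓ - 2.
  obtain ⟨j, rfl⟩ : ∃ j, ℓ = j + 1 := ⟨ℓ - 1, by omega⟩
  rw [prefactor, slope, show 2 * (j + 1) - 2 = 2 * j by omega]
  simp only [div_eq_mul_inv, mul_inv, mul_pow]
  rw [pow_succ]
  field_simp
  ring

/-- The outer amplitude of the mode `n - 2ℓ`. -/
noncomputable def ampRel (μ : Medium) (E r₀ : ℝ) (ℓ n : ℕ) : ℂ :=
  outAmplitude r₀ μ.eps2ω |(n : ℤ) - 2 * ℓ| (traceJump1 μ E r₀ ℓ n 0)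
    (fluxJumpAmp1 μ E r₀ ℓ n 0 / r₀)

/-- The outer amplitude of the mode `n`. -/
noncomputable def ampMid (μ : Medium) (E r₀ : ℝ) (ℓ n : ℕ) : ℂ :=
  outAmplitude r₀ μ.eps2ω n (traceJump1 μ E r₀ ℓ n 1) (fluxJumpAmp1 μ E r₀ ℓ n 1 / r₀)

/-- The outer amplitude of the mode `n + 2ℓ`. -/
noncomputable def ampSum (μ : Medium) (E r₀ : ℝ) (ℓ n : ℕ) : ℂ :=
  outAmplitude r₀ μ.eps2ω (n + 2 * ℓ) (traceJump1 μ E r₀ ℓ n 2) (fluxJumpAmp1 μ E r₀ ℓ n 2 / r₀)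

theorem outAmplitude_div (hr₀ : 0 < r₀) {eps g h : ℂ} {k : ℤ} (hk : k ≠ 0) :
    outAmplitude r₀ eps k g (h / r₀) = (eps * g - h / k) / (1 + eps) := by
  have hr : (r₀ : ℂ) ≠ 0 := by exact_mod_cast hr₀.ne'
  rw [outAmplitude, if_neg hk, div_mul_cancel₀ _ hr]

theorem ampMid_mul (hr₀ : 0 < r₀) (hℓ : 2 ≤ ℓ) (hn : ℓ < n) (he : μ.epsω ≠ -1)
    (hd : μ.eps2ω ≠ -1) : ampMid μ E r₀ ℓ n * r₀ ^ n = coeffMid μ E r₀ ℓ n := by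
  have he' := one_add_ne_zero_of_ne he
  have hd' := one_add_ne_zero_of_ne hd
  have hn0 : (n : ℂ) ≠ 0 := by exact_mod_cast (by omega : n ≠ 0)
  rw [ampMid, outAmplitude_div hr₀ (by omega), coeffMid, prefactor_eq hr₀ hℓ]
  congr 1
  simp only [traceJump1, fluxJumpAmp1, contrast, jump0, shear0, Matrix.cons_val_one,
    Matrix.cons_val_zero, Int.cast_natCast]
  generalize slope μ E r₀ ℓ = p
  field_simp
  ring

/-- Here v₀ enters only through (1 + ε_{2ω}) `second0Amp`, so its pole at 2ω cancels. -/
theorem ampSum_mul (hr₀ : 0 < r₀) (hℓ : 2 ≤ ℓ) (hn : ℓ < n) (hd : μ.eps2ω ≠ -1) :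
    ampSum μ E r₀ ℓ n * r₀ ^ (n + 2 * ℓ) = coeffSum μ E r₀ ℓ n := by
  have hd' := one_add_ne_zero_of_ne hd
  have hn0 : (n : ℂ) + 2 * ℓ ≠ 0 := by exact_mod_cast (by omega : n + 2 * ℓ ≠ 0)
  rw [ampSum, outAmplitude_div hr₀ (by omega), coeffSum, prefactor_eq hr₀ hℓ]
  congr 1
  simp only [traceJump1, fluxJumpAmp1, second0Amp, jump0, shear0, Matrix.cons_val]
  push_cast
  generalize slope μ E r₀ ℓ = p
  -- The frequency itself becomes the variable, so that the denominator to be cleared is a single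
  -- atom.
  obtain ⟨t, ht⟩ : ∃ t : ℂ, t = n + 2 * ℓ := ⟨_, rfl⟩
  have hn' : (n : ℂ) = t - 2 * ℓ := by linear_combination -ht
  rw [← ht] at hn0 ⊢
  rw [hn']
  field_simp
  ring

/-- The amplitude divides the flux jump by |n - 2ℓ|, so its sign relative to the trace jump depends
on the case. For n < 2ℓ the pole of `second0Amp` cancels as in the mode n + 2ℓ; for n > 2ℓ the term
ℓ(3ε_{2ω} - 1) `second0Amp` remains and makes the pole double. -/
theorem ampRel_mul (hr₀ : 0 < r₀) (hℓ : 2 ≤ ℓ) (hn2 : n ≠ 2 * ℓ) (he : μ.epsω ≠ -1)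
    (hd : μ.eps2ω ≠ -1) : ampRel μ E r₀ ℓ n * r₀ ^ relDegree ℓ n = coeffRel μ E r₀ ℓ n := by
  have he' := one_add_ne_zero_of_ne he
  have hd' := one_add_ne_zero_of_ne hd
  have hm : (n : ℤ) - 2 * ℓ ≠ 0 := by omega
  have hm0 : (n : ℂ) - 2 * ℓ ≠ 0 := by exact_mod_cast hm
  rw [ampRel, outAmplitude_div hr₀ (abs_ne_zero.2 hm), coeffRel, prefactor_eq hr₀ hℓ]
  congr 1
  simp only [traceJump1, fluxJumpAmp1, second0Amp, jump0, shear0, contrast, Matrix.cons_val_zero]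
  generalize slope μ E r₀ ℓ = p
  obtain ⟨t, ht⟩ : ∃ t : ℂ, t = n - 2 * ℓ := ⟨_, rfl⟩
  have hn' : (n : ℂ) = t + 2 * ℓ := by linear_combination -ht
  split_ifs with h
  · rw [abs_of_nonneg (by omega)]
    push_cast
    rw [← ht] at hm0 ⊢
    rw [hn']
    field_simp
    ring
  · rw [abs_of_nonpos (by omega)]
    push_cast
    rw [← ht] at hm0 ⊢
    rw [div_neg, hn']
    field_simp
    ring

theorem second1_out_circleMap (r θ : ℝ) :
    (second1 μ E r₀ ℓ n).out (circleMap 0 r θ)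
      = ampRel μ E r₀ ℓ n * (((r / r₀) ^ relDegree ℓ n)⁻¹ : ℝ) * cosMode (n - 2 * ℓ) θ
        + ampMid μ E r₀ ℓ n * (((r / r₀) ^ n)⁻¹ : ℝ) * cosMode n θ
        + ampSum μ E r₀ ℓ n * (((r / r₀) ^ (n + 2 * ℓ))⁻¹ : ℝ) * cosMode (n + 2 * ℓ) θ := by
  have h1 : (r / r₀) ^ (-|(n : ℤ) - 2 * ℓ|) = ((r / r₀) ^ relDegree ℓ n)⁻¹ := by
    rw [← natCast_relDegree, zpow_neg, zpow_natCast]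
  have h2 : (r / r₀) ^ (-(n : ℤ)) = ((r / r₀) ^ n)⁻¹ := by
    rw [zpow_neg, zpow_natCast]
  have h3 : (r / r₀) ^ (-((n : ℤ) + 2 * ℓ)) = ((r / r₀) ^ (n + 2 * ℓ))⁻¹ := by
    rw [zpow_neg]
    exact_mod_cast rfl
  simp only [second1, modalSolution, modal_circleMap, Fin.sum_univ_three, Matrix.cons_val_zero,
    Matrix.cons_val_one, Matrix.cons_val, cosMode_neg, cosMode_abs, h1, h2, h3, ampRel, ampMid,
    ampSum]

theorem out_eq_second1 (hr₀ : 0 < r₀) (hℓ : 2 ≤ ℓ) (hn : ℓ < n) (hn2 : n ≠ 2 * ℓ)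
    (he : μ.epsω ≠ -1) (hd : μ.eps2ω ≠ -1) {u₀ v₀ u₁ v₁ : Potential}
    (h : IsExpansion μ E r₀ ℓ n u₀ v₀ u₁ v₁) {x : ℂ} (hx : r₀ ≤ ‖x‖) :
    v₁.out x = (second1 μ E r₀ ℓ n).out x :=
  (IsExpansion.agree hr₀ he hd h (isExpansion_explicit hr₀ hℓ hn hn2 he hd)).2 (by simpa using hx)

/-- The modes of the first-order second-harmonic potential. -/
theorem out_circleMap (hr₀ : 0 < r₀) (hℓ : 2 ≤ ℓ) (hn : ℓ < n) (hn2 : n ≠ 2 * ℓ)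
    (he : μ.epsω ≠ -1) (hd : μ.eps2ω ≠ -1) {u₀ v₀ u₁ v₁ : Potential}
    (h : IsExpansion μ E r₀ ℓ n u₀ v₀ u₁ v₁) {r : ℝ} (θ : ℝ) (hr : r₀ < r) :
    v₁.out (circleMap 0 r θ)
      = coeffRel μ E r₀ ℓ n * (1 / r ^ relDegree ℓ n) * Real.cos ((n - 2 * ℓ) * θ)
        + coeffMid μ E r₀ ℓ n * (1 / r ^ n) * Real.cos (n * θ)
        + coeffSum μ E r₀ ℓ n * (1 / r ^ (n + 2 * ℓ)) * Real.cos ((n + 2 * ℓ) * θ) := by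
  have hrpos : 0 < r := hr₀.trans hr
  have hrc : (r : ℂ) ≠ 0 := by exact_mod_cast hrpos.ne'
  have hr₀c : (r₀ : ℂ) ≠ 0 := by exact_mod_cast hr₀.ne'
  rw [out_eq_second1 hr₀ hℓ hn hn2 he hd h (by rw [norm_circleMap_zero_of_nonneg hrpos.le]; exact
    hr.le), second1_out_circleMap, ← ampRel_mul hr₀ hℓ hn2 he hd, ← ampMid_mul hr₀ hℓ hn he hd,
    ← ampSum_mul hr₀ hℓ hn hd]
  have hpow : ∀ j : ℕ, ((((r / r₀) ^ j)⁻¹ : ℝ) : ℂ) = r₀ ^ j * (1 / r ^ j) := by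
    intro j
    push_cast
    rw [div_pow, inv_div, mul_one_div]
  simp only [hpow, cosMode]
  push_cast
  ring

/-! ### Radiation -/

/-- Because ℓ < n, no mode decays more slowly than |n - 2ℓ|. -/
theorem isMultipoleRadiation_out (hr₀ : 0 < r₀) (hℓ : 2 ≤ ℓ) (hn : ℓ < n) (hn2 : n ≠ 2 * ℓ)
    (he : μ.epsω ≠ -1) (hd : μ.eps2ω ≠ -1) {u₀ v₀ u₁ v₁ : Potential}
    (h : IsExpansion μ E r₀ ℓ n u₀ v₀ u₁ v₁) : IsMultipoleRadiation (relDegree ℓ n) v₁.out := by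
  refine ⟨⟨r₀, h.2.harmonic_v.harmonic_out⟩, ?_⟩
  have hev : ∀ᶠ x : ℂ in Bornology.cobounded ℂ, r₀ ≤ ‖x‖ :=
    tendsto_norm_cobounded_atTop.eventually_ge_atTop r₀
  refine IsBigO.congr' (isBigO_modalSolution (p := relDegree ℓ n) hr₀ ?_)
    (hev.mono fun x hx => (out_eq_second1 hr₀ hℓ hn hn2 he hd h hx).symm) EventuallyEq.rfl
  have hm := natCast_relDegree ℓ n
  have hm2 : (relDegree ℓ n : ℤ) ≤ n := by rw [relDegree]; omega
  simp only [Fin.forall_fin_succ, ← hm]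
  simp
  omega

theorem isDipoleRadiation_of_isMultipoleRadiation_one {v : ℂ → ℂ} (h : IsMultipoleRadiation 1 v) :
    IsDipoleRadiation v := by
  simpa [IsMultipoleRadiation, IsDipoleRadiation] using h

theorem isLittleO_inv_norm_pow (m : ℕ) : (fun x : ℂ => (‖x‖ ^ (m + 1))⁻¹)
    =o[Bornology.cobounded ℂ] fun x => (‖x‖ ^ m)⁻¹ := by
  have h := (isBigO_refl (fun x : ℂ => (‖x‖ ^ m)⁻¹) (Bornology.cobounded ℂ)).mul_isLittleO
    ((isLittleO_one_iff ℝ).2 tendsto_inv_norm_cobounded)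
  refine h.congr (fun x => ?_) fun x => mul_one _
  rw [pow_succ, mul_inv]

/-- The gap |n - 2ℓ| + 1 ≤ n makes the other two modes negligible, so only the leading mode decides.
-/
theorem isLittleO_out_iff (hr₀ : 0 < r₀) (hℓ : 2 ≤ ℓ) (hn : ℓ < n) (hn2 : n ≠ 2 * ℓ)
    (he : μ.epsω ≠ -1) (hd : μ.eps2ω ≠ -1) {u₀ v₀ u₁ v₁ : Potential}
    (h : IsExpansion μ E r₀ ℓ n u₀ v₀ u₁ v₁) :
    (v₁.out =o[Bornology.cobounded ℂ] fun x => (‖x‖ ^ relDegree ℓ n)⁻¹)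
      ↔ coeffRel μ E r₀ ℓ n = 0 := by
  have hr : (r₀ : ℂ) ≠ 0 := by exact_mod_cast hr₀.ne'
  set m := relDegree ℓ n with hmdef
  have hm := natCast_relDegree ℓ n
  rw [← hmdef] at hm
  have hm2 : (m : ℤ) + 1 ≤ n := by rw [hmdef, relDegree]; omega
  have hev : ∀ᶠ x : ℂ in Bornology.cobounded ℂ, r₀ ≤ ‖x‖ :=
    tendsto_norm_cobounded_atTop.eventually_ge_atTop r₀
  have hsplit : v₁.out =ᶠ[Bornology.cobounded ℂ]
      fun x => modal r₀ ![-(m : ℤ)] ![ampRel μ E r₀ ℓ n] x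
        + modal r₀ ![-(n : ℤ), -(n + 2 * ℓ)] ![ampMid μ E r₀ ℓ n, ampSum μ E r₀ ℓ n] x := by
    filter_upwards [hev] with x hx
    rw [out_eq_second1 hr₀ hℓ hn hn2 he hd h hx]
    simp only [second1, modalSolution, modal, Fin.sum_univ_two, Fin.sum_univ_three,
      Fin.sum_univ_one, Matrix.cons_val_zero, Matrix.cons_val_one, Matrix.cons_val, ← hm, ampRel,
      ampMid, ampSum]
    ring
  have hrest : modal r₀ ![-(n : ℤ), -(n + 2 * ℓ)] ![ampMid μ E r₀ ℓ n, ampSum μ E r₀ ℓ n]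
      =o[Bornology.cobounded ℂ] fun x => (‖x‖ ^ m)⁻¹ := by
    refine IsBigO.trans_isLittleO (isBigO_modal (p := m + 1) hr₀ fun i => Or.inr ?_)
      (isLittleO_inv_norm_pow m)
    fin_cases i
    · simp; omega
    · simp; omega
  have hlead : (v₁.out =o[Bornology.cobounded ℂ] fun x => (‖x‖ ^ m)⁻¹) ↔
      modal r₀ ![-(m : ℤ)] ![ampRel μ E r₀ ℓ n] =o[Bornology.cobounded ℂ]
        fun x => (‖x‖ ^ m)⁻¹ := by
    rw [isLittleO_congr hsplit EventuallyEq.rfl]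
    exact ⟨fun h' => (h'.sub hrest).congr_left fun x => by simp, fun h' => h'.add hrest⟩
  rw [hlead, ← ampRel_mul hr₀ hℓ hn2 he hd]
  constructor
  · intro ho
    -- The leading mode is tested along the positive real axis, where its cosine is 1 and r^m times
    -- it is constant.
    have htend : Tendsto (fun r : ℝ => (r : ℂ)) atTop (Bornology.cobounded ℂ) := by
      rw [← tendsto_norm_atTop_iff_cobounded]
      simpa using tendsto_abs_atTop_atTop
    have h2 : (fun r : ℝ => (r : ℂ) ^ m * (modal r₀ ![-(m : ℤ)] ![ampRel μ E r₀ ℓ n] ∘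
        fun r : ℝ => (r : ℂ)) r) =ᶠ[atTop] fun _ => ampRel μ E r₀ ℓ n * r₀ ^ m := by
      filter_upwards [eventually_gt_atTop 0] with r hr0
      have hrc : (r : ℂ) ≠ 0 := by exact_mod_cast hr0.ne'
      have h3 : (r : ℂ) = circleMap 0 r 0 := by simp [circleMap]
      rw [Function.comp_apply, h3, modal_circleMap, ← h3]
      simp [cosMode, div_pow]
      field_simp
    have h4 : (fun r : ℝ => ((r : ℂ) ^ m) * (((‖(r : ℂ)‖ ^ m)⁻¹ : ℝ) : ℂ)) =ᶠ[atTop]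
        fun _ => (1 : ℂ) := by
      filter_upwards [eventually_gt_atTop 0] with r hr0
      have hrc : (r : ℂ) ≠ 0 := by exact_mod_cast hr0.ne'
      rw [Complex.norm_real, Real.norm_eq_abs, abs_of_pos hr0]
      push_cast
      field_simp
    have h5 : (fun _ : ℝ => ampRel μ E r₀ ℓ n * (r₀ : ℂ) ^ m) =o[atTop] fun _ => (1 : ℂ) := by
      refine IsLittleO.congr' ?_ h2 h4
      refine (isBigO_refl (fun r : ℝ => (r : ℂ) ^ m) atTop).mul_isLittleO ?_
      refine (ho.comp_tendsto htend).trans_isBigO (IsBigO.of_bound 1 ?_)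
      refine Eventually.of_forall fun r => ?_
      simp
    exact isLittleO_const_const_iff.1 h5
  · intro h0
    have h1 : ampRel μ E r₀ ℓ n = 0 := (mul_eq_zero.1 h0).resolve_right (pow_ne_zero _ hr)
    have h2 : modal r₀ ![-(m : ℤ)] ![ampRel μ E r₀ ℓ n] = fun _ => 0 := by
      funext x
      simp [modal, h1]
    rw [h2]
    exact isLittleO_zero _ _

end

section

/-! ### Resonance -/

/-- The numerical factor of the coefficient `M_{|n-2ℓ|}`. -/
noncomputable def relScale (E r₀ : ℝ) (ℓ n : ℕ) : ℂ :=
  8 * Real.pi * E ^ 2 * ℓ ^ 2 * r₀ ^ (2 * ℓ - 2) * r₀ ^ relDegree ℓ n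

/-- The part of `M_{|n-2ℓ|}` that is doubly resonant at `2ω`. -/
noncomputable def relDouble (χperp χpar : ℂ) (ℓ n : ℕ) (e d : ℂ) : ℂ :=
  if 2 * ℓ < n then
    ℓ * (d - 3) * (χperp * e ^ 2 * d)
      + 2 * ((n - 2 * ℓ + 1) + (n + 2 * ℓ + 1) * d) * (χpar * e)
  else (1 + d) * (ℓ * (χperp * e ^ 2 * d) - 2 * (n - 2 * ℓ + 1) * (χpar * e))

/-- The part of `M_{|n-2ℓ|}` that is triply resonant at `ω`. -/
noncomputable def relTriple (χperp : ℂ) (ℓ n : ℕ) (e d : ℂ) : ℂ :=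
  ((n - ℓ - 1) * e - (3 * n - 3 * ℓ + 1)) * (χperp * e ^ 2 * d)

/-- The combined resonance profile of both parts. -/
noncomputable def profile (e d p q : ℂ) : ℂ :=
  (p / (1 + d) + q / (1 + e)) / ((1 + d) * (1 + e) ^ 2)

variable {E r₀ : ℝ} {ℓ n : ℕ} {χperp χpar e d : ℂ}

theorem relScale_ne_zero (hE : 0 < E) (hr₀ : 0 < r₀) (hℓ : 2 ≤ ℓ) : relScale E r₀ ℓ n ≠ 0 := by
  have h1 : (r₀ : ℂ) ≠ 0 := by exact_mod_cast hr₀.ne'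
  have h2 : (E : ℂ) ≠ 0 := by exact_mod_cast hE.ne'
  have h3 : (ℓ : ℂ) ≠ 0 := by exact_mod_cast (by omega : ℓ ≠ 0)
  have h4 : (Real.pi : ℂ) ≠ 0 := by exact_mod_cast Real.pi_ne_zero
  simp [relScale, h1, h2, h3]

theorem coeffRel_eq_profile (he : e ≠ -1) (hd : d ≠ -1) :
    coeffRel ⟨e, d, χperp, χpar⟩ E r₀ ℓ n = relScale E r₀ ℓ n *
      profile e d (relDouble χperp χpar ℓ n e d) (relTriple χperp ℓ n e d) := by
  have he' := one_add_ne_zero_of_ne he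
  have hd' := one_add_ne_zero_of_ne hd
  simp only [coeffRel, relScale, profile, relDouble, relTriple, prefactor]
  split_ifs
  · field_simp
    ring
  · field_simp
    ring

/-- The factor 1 + d inside the first argument cancels one denominator of `profile`: this mode has
only a simple pole at 2ω. The same device serves `coeffSum_eq_profile`. -/
theorem coeffMid_eq_profile (he : e ≠ -1) (hd : d ≠ -1) :
    coeffMid ⟨e, d, χperp, χpar⟩ E r₀ ℓ n
      = 16 * Real.pi * E ^ 2 * ℓ ^ 2 * r₀ ^ (2 * ℓ - 2) * r₀ ^ n *
        profile e d ((1 + d) * ((ℓ - 1) * (χperp * e ^ 2 * d)))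
          (-((1 - e) * (n - ℓ) * (χperp * e ^ 2 * d + 2 * (χpar * e)))) := by
  have he' := one_add_ne_zero_of_ne he
  have hd' := one_add_ne_zero_of_ne hd
  simp only [coeffMid, profile, prefactor]
  field_simp
  ring

theorem coeffSum_eq_profile (hd : d ≠ -1) :
    coeffSum ⟨e, d, χperp, χpar⟩ E r₀ ℓ n
      = 8 * Real.pi * E ^ 2 * ℓ ^ 2 * r₀ ^ (2 * ℓ - 2) * r₀ ^ (n + 2 * ℓ) *
        profile e d ((1 + d) * ((n + 2 * ℓ - 1) * (χperp * e ^ 2 * d + 2 * (χpar * e)))) 0 := by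
  have hd' := one_add_ne_zero_of_ne hd
  simp only [coeffSum, profile, prefactor]
  rw [mul_div_cancel_left₀ _ hd']
  ring

/-- The size of the resonance profile, as a function of the distances to the two resonances. -/
noncomputable def weight (a b : ℝ) : ℝ := 1 / (b * a ^ 2) * (1 / b + 1 / a)

theorem weight_nonneg {a b : ℝ} (ha : 0 ≤ a) (hb : 0 ≤ b) : 0 ≤ weight a b := by
  unfold weight; positivity

/-- Continuity bounds p and q on the compact product of two closed balls about -1, and the triangle
inequality leaves `weight`. -/
theorem exists_norm_profile_le {p q : ℂ → ℂ → ℂ} (hp : Continuous fun z : ℂ × ℂ => p z.1 z.2)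
    (hq : Continuous fun z : ℂ × ℂ => q z.1 z.2) (c : ℂ) (R : ℝ) :
    ∃ C : ℝ, ∀ e d : ℂ, ‖1 + e‖ ≤ R → ‖1 + d‖ ≤ R →
      ‖c * profile e d (p e d) (q e d)‖ ≤ C * weight ‖1 + e‖ ‖1 + d‖ := by
  have hK : IsCompact (closedBall (-1 : ℂ) R ×ˢ closedBall (-1 : ℂ) R) :=
    (isCompact_closedBall _ _).prod (isCompact_closedBall _ _)
  obtain ⟨A, hA⟩ := hK.exists_bound_of_continuousOn hp.continuousOn
  obtain ⟨B, hB⟩ := hK.exists_bound_of_continuousOn hq.continuousOn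
  refine ⟨‖c‖ * max A B, fun e d he hd => ?_⟩
  have hmem : (e, d) ∈ closedBall (-1 : ℂ) R ×ˢ closedBall (-1 : ℂ) R := by
    simp only [Set.mem_prod, mem_closedBall, dist_eq_norm, sub_neg_eq_add]
    exact ⟨by rwa [add_comm], by rwa [add_comm]⟩
  have h1 : ‖p e d‖ ≤ max A B := (hA _ hmem).trans (le_max_left _ _)
  have h2 : ‖q e d‖ ≤ max A B := (hB _ hmem).trans (le_max_right _ _)
  rw [norm_mul, mul_assoc, profile, norm_div, norm_mul, norm_pow]
  refine mul_le_mul_of_nonneg_left ?_ (norm_nonneg c)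
  have h3 : ‖p e d / (1 + d) + q e d / (1 + e)‖
      ≤ max A B * (1 / ‖1 + d‖ + 1 / ‖1 + e‖) := by
    refine (norm_add_le _ _).trans ?_
    rw [norm_div, norm_div, mul_add, mul_one_div, mul_one_div]
    gcongr
  calc ‖p e d / (1 + d) + q e d / (1 + e)‖ / (‖1 + d‖ * ‖1 + e‖ ^ 2)
      ≤ max A B * (1 / ‖1 + d‖ + 1 / ‖1 + e‖) / (‖1 + d‖ * ‖1 + e‖ ^ 2) := by gcongr
    _ = max A B * weight ‖1 + e‖ ‖1 + d‖ := by rw [weight]; ring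

theorem continuous_relDouble (χperp χpar : ℂ) (ℓ n : ℕ) :
    Continuous fun z : ℂ × ℂ => relDouble χperp χpar ℓ n z.1 z.2 := by
  unfold relDouble
  split_ifs <;> fun_prop

theorem continuous_relTriple (χperp : ℂ) (ℓ n : ℕ) :
    Continuous fun z : ℂ × ℂ => relTriple χperp ℓ n z.1 z.2 := by
  unfold relTriple
  fun_prop

theorem norm_second1_out_le (μ : Medium) (hr₀ : 0 < r₀) {x : ℂ} (hx : r₀ ≤ ‖x‖) :
    ‖(second1 μ E r₀ ℓ n).out x‖
      ≤ ‖ampRel μ E r₀ ℓ n‖ + ‖ampMid μ E r₀ ℓ n‖ + ‖ampSum μ E r₀ ℓ n‖ := by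
  rw [← circleMap_norm_arg x, second1_out_circleMap]
  have hpow : ∀ (c : ℂ) (j : ℕ) (k : ℤ),
      ‖c * (((‖x‖ / r₀) ^ j)⁻¹ : ℝ) * cosMode k x.arg‖ ≤ ‖c‖ := by
    intro c j k
    have h1 : 1 ≤ (‖x‖ / r₀) ^ j := one_le_pow₀ ((one_le_div hr₀).2 hx)
    rw [norm_mul, norm_mul, Complex.norm_real, Real.norm_eq_abs, abs_of_nonneg (by positivity)]
    calc ‖c‖ * ((‖x‖ / r₀) ^ j)⁻¹ * ‖cosMode k x.arg‖ ≤ ‖c‖ * 1 * 1 := by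
          gcongr
          · exact inv_le_one_of_one_le₀ h1
          · exact norm_cosMode_le k _
      _ = ‖c‖ := by ring
  exact norm_add₃_le.trans (add_le_add_three (hpow _ _ _) (hpow _ _ _) (hpow _ _ _))

/-- Uniform bound of the first-order second-harmonic potential near the resonances. -/
theorem exists_norm_out_le (χperp χpar : ℂ) (hr₀ : 0 < r₀) (hℓ : 2 ≤ ℓ) (hn : ℓ < n)
    (hn2 : n ≠ 2 * ℓ) (R : ℝ) :
    ∃ C : ℝ, 0 ≤ C ∧ ∀ e d : ℂ, e ≠ -1 → d ≠ -1 → ‖1 + e‖ ≤ R → ‖1 + d‖ ≤ R →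
      ∀ u₀ v₀ u₁ v₁ : Potential,
        IsExpansion ⟨e, d, χperp, χpar⟩ E r₀ ℓ n u₀ v₀ u₁ v₁ → ∀ x : ℂ, r₀ < ‖x‖ →
          ‖v₁.out x‖ ≤ C * weight ‖1 + e‖ ‖1 + d‖ := by
  obtain ⟨C₁, h₁⟩ := exists_norm_profile_le (continuous_relDouble χperp χpar ℓ n)
    -- Dividing by the power of r₀ turns the multipole coefficient into the amplitude on the circle,
    -- which bounds its mode for every ‖x‖ ≥ r₀.
    (continuous_relTriple χperp ℓ n) (relScale E r₀ ℓ n / r₀ ^ relDegree ℓ n) R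
  obtain ⟨C₂, h₂⟩ := exists_norm_profile_le
    (p := fun e d => (1 + d) * ((ℓ - 1) * (χperp * e ^ 2 * d)))
    (q := fun e d => -((1 - e) * (n - ℓ) * (χperp * e ^ 2 * d + 2 * (χpar * e))))
    (by fun_prop) (by fun_prop)
    (16 * Real.pi * E ^ 2 * ℓ ^ 2 * r₀ ^ (2 * ℓ - 2) * r₀ ^ n / r₀ ^ n) R
  obtain ⟨C₃, h₃⟩ := exists_norm_profile_le
    (p := fun e d => (1 + d) * ((n + 2 * ℓ - 1) * (χperp * e ^ 2 * d + 2 * (χpar * e))))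
    (q := fun _ _ => 0) (by fun_prop) (by fun_prop)
    (8 * Real.pi * E ^ 2 * ℓ ^ 2 * r₀ ^ (2 * ℓ - 2) * r₀ ^ (n + 2 * ℓ) / r₀ ^ (n + 2 * ℓ)) R
  refine ⟨max 0 (C₁ + C₂ + C₃), le_max_left _ _, ?_⟩
  intro e d he hd heR hdR u₀ v₀ u₁ v₁ h x hx
  have hr : ∀ j : ℕ, (r₀ : ℂ) ^ j ≠ 0 := fun j => pow_ne_zero j (by exact_mod_cast hr₀.ne')
  have hw : 0 ≤ weight ‖1 + e‖ ‖1 + d‖ := weight_nonneg (norm_nonneg _) (norm_nonneg _)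
  rw [out_eq_second1 hr₀ hℓ hn hn2 he hd h hx.le]
  refine (norm_second1_out_le _ hr₀ hx.le).trans ?_
  have a₁ := h₁ e d heR hdR
  have a₂ := h₂ e d heR hdR
  have a₃ := h₃ e d heR hdR
  rw [div_mul_eq_mul_div, ← coeffRel_eq_profile he hd, ← ampRel_mul hr₀ hℓ hn2 he hd,
    mul_div_cancel_right₀ _ (hr _)] at a₁
  rw [div_mul_eq_mul_div, ← coeffMid_eq_profile he hd, ← ampMid_mul hr₀ hℓ hn he hd,
    mul_div_cancel_right₀ _ (hr _)] at a₂
  rw [div_mul_eq_mul_div, ← coeffSum_eq_profile hd, ← ampSum_mul hr₀ hℓ hn hd,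
    mul_div_cancel_right₀ _ (hr _)] at a₃
  calc _ ≤ (C₁ + C₂ + C₃) * weight ‖1 + e‖ ‖1 + d‖ := by linarith
    _ ≤ _ := mul_le_mul_of_nonneg_right (le_max_right _ _) hw

/-- In this and the next three bounds the dominant pole is factored out, and the remaining ratio of
distances is at most a constant in the given regime. -/
theorem weight_le_of_left_le_one {a b : ℝ} (ha : 0 < a) (ha1 : a ≤ 1) (hb : 0 < b) :
    weight a b ≤ (1 / b * (1 / b + 1)) / a ^ 3 := by
  have h : weight a b = (1 / b * (a / b + 1)) / a ^ 3 := by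
    rw [weight]; field_simp
  rw [h]
  gcongr

theorem weight_le_of_right_le_one {a b : ℝ} (ha : 0 < a) (hb : 0 < b) (hb1 : b ≤ 1) :
    weight a b ≤ (1 / a ^ 2 * (1 + 1 / a)) / b ^ 2 := by
  have h : weight a b = (1 / a ^ 2 * (1 + b / a)) / b ^ 2 := by
    rw [weight]; field_simp
  rw [h]
  gcongr

theorem weight_le_of_right_le_left {a b : ℝ} (hb : 0 < b) (hba : b ≤ a) :
    weight a b ≤ 2 / (a ^ 2 * b ^ 2) := by
  have ha := hb.trans_le hba
  have h : weight a b = (1 + b / a) / (a ^ 2 * b ^ 2) := by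
    rw [weight]; field_simp
  rw [h]
  have : b / a ≤ 1 := (div_le_one ha).2 hba
  gcongr
  linarith

theorem weight_le_of_left_le_right {a b : ℝ} (ha : 0 < a) (hab : a ≤ b) :
    weight a b ≤ 2 / (a ^ 3 * b) := by
  have hb := ha.trans_le hab
  have h : weight a b = (1 + a / b) / (a ^ 3 * b) := by
    rw [weight]; field_simp; ring
  rw [h]
  have : a / b ≤ 1 := (div_le_one hb).2 hab
  gcongr
  linarith

/-- The resonance profile at `ω`. -/
theorem relTriple_neg_one_ne_zero (hn : ℓ < n) (hχ : χperp ≠ 0) (hd0 : d ≠ 0) :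
    relTriple χperp ℓ n (-1) d ≠ 0 := by
  have h1 : (n : ℂ) - ℓ ≠ 0 := sub_ne_zero.2 (by exact_mod_cast hn.ne')
  have h2 : relTriple χperp ℓ n (-1) d = -4 * (n - ℓ) * χperp * d := by
    rw [relTriple]; ring
  rw [h2]
  simp [h1, hχ, hd0]

/-- This value is the source of the condition χ_⊥ ε_ω ≠ 2χ_∥, and at ε_ω = -1 of χ_⊥ + 2χ_∥ ≠ 0. -/
theorem relDouble_neg_one (h : 2 * ℓ < n) :
    relDouble χperp χpar ℓ n e (-1) = 4 * ℓ * e * (χperp * e - 2 * χpar) := by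
  rw [relDouble, if_pos h]; ring

open Polynomial in
/-- The leading multipole vanishes only for finitely many permittivities at frequency `ω`. -/
theorem finite_setOf_coeffRel_eq_zero (hE : 0 < E) (hr₀ : 0 < r₀) (hℓ : 2 ≤ ℓ) (hn : ℓ < n)
    (hχ : χperp ≠ 0) (hd0 : d ≠ 0) (hd : d ≠ -1) :
    {e : ℂ | coeffRel ⟨e, d, χperp, χpar⟩ E r₀ ℓ n = 0}.Finite := by
  have hd' := one_add_ne_zero_of_ne hd
  -- P is the numerator of the coefficient as a polynomial in ε_ω. It is not zero, since at -1 only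
  -- the triply resonant part survives.
  obtain ⟨P, hP⟩ : ∃ P : ℂ[X], ∀ e, P.eval e
      = relDouble χperp χpar ℓ n e d * (1 + e) + relTriple χperp ℓ n e d * (1 + d) := by
    unfold relDouble relTriple
    split_ifs
    · refine ⟨(C (ℓ * (d - 3) * (χperp * d)) * X ^ 2
        + C (2 * ((n - 2 * ℓ + 1) + (n + 2 * ℓ + 1) * d) * χpar) * X) * (1 + X)
        + (C (n - ℓ - 1 : ℂ) * X - C (3 * n - 3 * ℓ + 1 : ℂ)) * (C (χperp * d * (1 + d)) * X ^ 2),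
        fun e => ?_⟩
      simp only [eval_add, eval_sub, eval_mul, eval_C, eval_X, eval_pow, eval_one]
      ring
    · refine ⟨(C ((1 + d) * (ℓ * (χperp * d))) * X ^ 2
        - C ((1 + d) * (2 * (n - 2 * ℓ + 1) * χpar)) * X) * (1 + X)
        + (C (n - ℓ - 1 : ℂ) * X - C (3 * n - 3 * ℓ + 1 : ℂ)) * (C (χperp * d * (1 + d)) * X ^ 2),
        fun e => ?_⟩
      simp only [eval_add, eval_sub, eval_mul, eval_C, eval_X, eval_pow, eval_one]
      ring
  have hP0 : P ≠ 0 := by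
    rintro rfl
    have h := hP (-1)
    rw [eval_zero, add_neg_cancel, mul_zero, zero_add] at h
    exact mul_ne_zero (relTriple_neg_one_ne_zero hn hχ hd0) hd' h.symm
  -- The point -1 is added separately: division by zero makes the coefficient vanish there although
  -- P does not.
  refine ((P.rootSet_finite ℂ).union (Set.finite_singleton (-1))).subset fun e he => ?_
  by_cases he1 : e = -1
  · exact Or.inr he1
  left
  have he' := one_add_ne_zero_of_ne he1
  have h0 : coeffRel ⟨e, d, χperp, χpar⟩ E r₀ ℓ n = 0 := he
  rw [coeffRel_eq_profile he1 hd] at h0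
  have h1 := (mul_eq_zero.1 h0).resolve_left (relScale_ne_zero hE hr₀ hℓ)
  rw [mem_rootSet_of_ne hP0, coe_aeval_eq_eval, hP]
  rw [profile, div_add_div _ _ hd' he', div_div, div_eq_zero_iff] at h1
  rcases h1 with h1 | h1
  · linear_combination h1
  · exact absurd h1 (by simp [he', hd'])

/-! ### Exact orders at the resonances. -/

theorem tendsto_one_add_nhdsNE_neg_one :
    Tendsto (fun z : ℂ => 1 + z) (𝓝[≠] (-1)) (𝓝 0) := by
  have h : Continuous fun z : ℂ => 1 + z := by fun_prop
  have := h.tendsto (-1)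
  rw [add_neg_cancel] at this
  exact this.mono_left nhdsWithin_le_nhds

theorem eventually_nhdsNE_neg_one : ∀ᶠ z : ℂ in 𝓝[≠] (-1), z ≠ -1 := self_mem_nhdsWithin

/-- Multiplied by (1 + ε_ω)³, the coefficient tends to a nonzero multiple of `relTriple` at -1; the
other part keeps a factor 1 + ε_ω. -/
theorem coeffRel_isTheta_omega (hE : 0 < E) (hr₀ : 0 < r₀) (hℓ : 2 ≤ ℓ) (hn : ℓ < n)
    (hd : d ≠ -1) (hχ : χperp ≠ 0) (hd0 : d ≠ 0) :
    (fun e : ℂ => coeffRel ⟨e, d, χperp, χpar⟩ E r₀ ℓ n) =Θ[𝓝[≠] (-1)]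
      fun e : ℂ => ((1 + e) ^ 3)⁻¹ := by
  have hd' := one_add_ne_zero_of_ne hd
  have hP : Tendsto (fun e => relDouble χperp χpar ℓ n e d) (𝓝[≠] (-1))
      (𝓝 (relDouble χperp χpar ℓ n (-1) d)) :=
    (((continuous_relDouble χperp χpar ℓ n).comp (Continuous.prodMk_left d)).tendsto _).mono_left
      nhdsWithin_le_nhds
  have hQ : Tendsto (fun e => relTriple χperp ℓ n e d) (𝓝[≠] (-1))
      (𝓝 (relTriple χperp ℓ n (-1) d)) :=
    (((continuous_relTriple χperp ℓ n).comp (Continuous.prodMk_left d)).tendsto _).mono_left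
      nhdsWithin_le_nhds
  have hlim := ((((hP.mul tendsto_one_add_nhdsNE_neg_one).div_const (1 + d)).add hQ).div_const
    (1 + d)).const_mul (relScale E r₀ ℓ n)
  refine (isTheta_of_div_tendsto_nhds_ne_zero (hlim.congr' ?_) ?_).symm
  · filter_upwards [eventually_nhdsNE_neg_one] with e he
    have he' := one_add_ne_zero_of_ne he
    rw [coeffRel_eq_profile he hd, profile]
    field_simp
  · rw [mul_zero, zero_div, zero_add]
    exact mul_ne_zero (relScale_ne_zero hE hr₀ hℓ)
      (div_ne_zero (relTriple_neg_one_ne_zero hn hχ hd0) hd')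

/-- After multiplication by (1 + ε_{2ω})² only `relDouble` survives in the limit. -/
theorem coeffRel_isTheta_two_omega (hE : 0 < E) (hr₀ : 0 < r₀) (hℓ : 2 ≤ ℓ) (hn : 2 * ℓ < n)
    (he : e ≠ -1) (he0 : e ≠ 0) (hχ : χperp * e ≠ 2 * χpar) :
    (fun d : ℂ => coeffRel ⟨e, d, χperp, χpar⟩ E r₀ ℓ n) =Θ[𝓝[≠] (-1)]
      fun d : ℂ => ((1 + d) ^ 2)⁻¹ := by
  have he' := one_add_ne_zero_of_ne he
  have hℓ0 : (ℓ : ℂ) ≠ 0 := by exact_mod_cast (by omega : ℓ ≠ 0)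
  have hP : Tendsto (fun d => relDouble χperp χpar ℓ n e d) (𝓝[≠] (-1))
      (𝓝 (relDouble χperp χpar ℓ n e (-1))) :=
    (((continuous_relDouble χperp χpar ℓ n).comp (Continuous.prodMk_right e)).tendsto _).mono_left
      nhdsWithin_le_nhds
  have hQ : Tendsto (fun d => relTriple χperp ℓ n e d) (𝓝[≠] (-1))
      (𝓝 (relTriple χperp ℓ n e (-1))) :=
    (((continuous_relTriple χperp ℓ n).comp (Continuous.prodMk_right e)).tendsto _).mono_left
      nhdsWithin_le_nhds
  have hlim := ((hP.add ((hQ.mul tendsto_one_add_nhdsNE_neg_one).div_const (1 + e))).div_const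
    ((1 + e) ^ 2)).const_mul (relScale E r₀ ℓ n)
  refine (isTheta_of_div_tendsto_nhds_ne_zero (hlim.congr' ?_) ?_).symm
  · filter_upwards [eventually_nhdsNE_neg_one] with d hd
    have hd' := one_add_ne_zero_of_ne hd
    rw [coeffRel_eq_profile he hd, profile]
    field_simp
  · rw [mul_zero, zero_div, add_zero, relDouble_neg_one hn]
    exact mul_ne_zero (relScale_ne_zero hE hr₀ hℓ) (div_ne_zero
      (mul_ne_zero (by simp [hℓ0, he0]) (sub_ne_zero.2 hχ)) (pow_ne_zero 2 he'))

theorem eventually_nhdsNE_prod_neg_one (F : Filter (ℂ × ℂ)) :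
    ∀ᶠ z : ℂ × ℂ in (𝓝[≠] (-1) ×ˢ 𝓝[≠] (-1)) ⊓ F, z.1 ≠ -1 ∧ z.2 ≠ -1 :=
  (eventually_nhdsNE_neg_one.prod_mk eventually_nhdsNE_neg_one).filter_mono inf_le_left

theorem tendsto_uncurry_neg_one {p : ℂ → ℂ → ℂ} (hp : Continuous fun z : ℂ × ℂ => p z.1 z.2)
    (F : Filter (ℂ × ℂ)) :
    Tendsto (fun z : ℂ × ℂ => p z.1 z.2) ((𝓝[≠] (-1) ×ˢ 𝓝[≠] (-1)) ⊓ F) (𝓝 (p (-1) (-1))) := by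
  refine (hp.tendsto ((-1 : ℂ), (-1 : ℂ))).mono_left (inf_le_left.trans ?_)
  rw [nhds_prod_eq]
  exact Filter.prod_mono nhdsWithin_le_nhds nhdsWithin_le_nhds

/-- After rescaling, `relTriple` is multiplied by (1 + ε_{2ω})/(1 + ε_ω), which the filter sends to
0. In `coeffRel_isTheta_triple` the two parts exchange roles. -/
theorem coeffRel_isTheta_double (hE : 0 < E) (hr₀ : 0 < r₀) (hℓ : 2 ≤ ℓ) (hn : 2 * ℓ < n)
    (hχ : χperp + 2 * χpar ≠ 0) :
    (fun p : ℂ × ℂ => coeffRel ⟨p.1, p.2, χperp, χpar⟩ E r₀ ℓ n)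
      =Θ[(𝓝[≠] (-1) ×ˢ 𝓝[≠] (-1)) ⊓ comap (fun p : ℂ × ℂ => (1 + p.2) / (1 + p.1)) (𝓝 0)]
        fun p : ℂ × ℂ => ((1 + p.1) ^ 2 * (1 + p.2) ^ 2)⁻¹ := by
  have hℓ0 : (ℓ : ℂ) ≠ 0 := by exact_mod_cast (by omega : ℓ ≠ 0)
  set F := comap (fun p : ℂ × ℂ => (1 + p.2) / (1 + p.1)) (𝓝 0)
  have hratio : Tendsto (fun p : ℂ × ℂ => (1 + p.2) / (1 + p.1))
      ((𝓝[≠] (-1) ×ˢ 𝓝[≠] (-1)) ⊓ F) (𝓝 0) := tendsto_comap.mono_left inf_le_right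
  have hlim := ((tendsto_uncurry_neg_one (continuous_relDouble χperp χpar ℓ n) F).add
    ((tendsto_uncurry_neg_one (continuous_relTriple χperp ℓ n) F).mul hratio)).const_mul
      (relScale E r₀ ℓ n)
  refine (isTheta_of_div_tendsto_nhds_ne_zero (hlim.congr' ?_) ?_).symm
  · filter_upwards [eventually_nhdsNE_prod_neg_one F] with z hz
    have he' := one_add_ne_zero_of_ne hz.1
    have hd' := one_add_ne_zero_of_ne hz.2
    rw [coeffRel_eq_profile hz.1 hz.2, profile]
    field_simp
  · rw [mul_zero, add_zero, relDouble_neg_one hn]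
    refine mul_ne_zero (relScale_ne_zero hE hr₀ hℓ) (mul_ne_zero (by simp [hℓ0]) fun h => hχ ?_)
    linear_combination -h

theorem coeffRel_isTheta_triple (hE : 0 < E) (hr₀ : 0 < r₀) (hℓ : 2 ≤ ℓ) (hn : ℓ < n)
    (hχ : χperp ≠ 0) :
    (fun p : ℂ × ℂ => coeffRel ⟨p.1, p.2, χperp, χpar⟩ E r₀ ℓ n)
      =Θ[(𝓝[≠] (-1) ×ˢ 𝓝[≠] (-1)) ⊓ comap (fun p : ℂ × ℂ => (1 + p.1) / (1 + p.2)) (𝓝 0)]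
        fun p : ℂ × ℂ => ((1 + p.1) ^ 3 * (1 + p.2))⁻¹ := by
  set F := comap (fun p : ℂ × ℂ => (1 + p.1) / (1 + p.2)) (𝓝 0)
  have hratio : Tendsto (fun p : ℂ × ℂ => (1 + p.1) / (1 + p.2))
      ((𝓝[≠] (-1) ×ˢ 𝓝[≠] (-1)) ⊓ F) (𝓝 0) := tendsto_comap.mono_left inf_le_right
  have hlim := (((tendsto_uncurry_neg_one (continuous_relDouble χperp χpar ℓ n) F).mul hratio).add
    (tendsto_uncurry_neg_one (continuous_relTriple χperp ℓ n) F)).const_mul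
      (relScale E r₀ ℓ n)
  refine (isTheta_of_div_tendsto_nhds_ne_zero (hlim.congr' ?_) ?_).symm
  · filter_upwards [eventually_nhdsNE_prod_neg_one F] with z hz
    have he' := one_add_ne_zero_of_ne hz.1
    have hd' := one_add_ne_zero_of_ne hz.2
    rw [coeffRel_eq_profile hz.1 hz.2, profile]
    field_simp
  · rw [mul_zero, zero_add]
    exact mul_ne_zero (relScale_ne_zero hE hr₀ hℓ)
      (relTriple_neg_one_ne_zero hn hχ (neg_ne_zero.2 one_ne_zero))

end

end SecondHarmonic

/-! ### Assembly of the main theorem. -/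

theorem mainTheorem4 (E r₀ : ℝ) (hE : 0 < E) (hr₀ : 0 < r₀) (χperp χpar : ℂ) (ℓ n : ℕ)
    (hℓ : 2 ≤ ℓ) (hn : ℓ < n) (hn2 : n ≠ 2 * ℓ) :
    -- the leading-order and first-order systems are solvable away from the resonances
    (∀ e d : ℂ, e ≠ -1 → d ≠ -1 →
      ∃ u₀ v₀ u₁ v₁ : Potential, IsExpansion ⟨e, d, χperp, χpar⟩ E r₀ ℓ n u₀ v₀ u₁ v₁) ∧
    -- modes and radiation of the first-order second-harmonic potential
    (∀ e d : ℂ, e ≠ -1 → d ≠ -1 → ∀ u₀ v₀ u₁ v₁ : Potential,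
      IsExpansion ⟨e, d, χperp, χpar⟩ E r₀ ℓ n u₀ v₀ u₁ v₁ →
        (∀ r θ : ℝ, r₀ < r →
          v₁.out (circleMap 0 r θ) =
            coeffRel ⟨e, d, χperp, χpar⟩ E r₀ ℓ n * (1 / r ^ relDegree ℓ n)
                * Real.cos ((n - 2 * ℓ) * θ)
              + coeffMid ⟨e, d, χperp, χpar⟩ E r₀ ℓ n * (1 / r ^ n) * Real.cos (n * θ)
              + coeffSum ⟨e, d, χperp, χpar⟩ E r₀ ℓ n * (1 / r ^ (n + 2 * ℓ))
                * Real.cos ((n + 2 * ℓ) * θ)) ∧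
        (relDegree ℓ n = 1 → IsDipoleRadiation v₁.out) ∧
        (∀ m : ℕ, relDegree ℓ n = m → IsMultipoleRadiation m v₁.out ∧
          ((v₁.out =o[Bornology.cobounded ℂ] fun x => (‖x‖ ^ m)⁻¹) ↔
            coeffRel ⟨e, d, χperp, χpar⟩ E r₀ ℓ n = 0))) ∧
    -- the leading multipole is present for all but finitely many permittivities at frequency ω
    (χperp ≠ 0 → ∀ d : ℂ, d ≠ 0 → d ≠ -1 →
      {e : ℂ | coeffRel ⟨e, d, χperp, χpar⟩ E r₀ ℓ n = 0}.Finite) ∧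
    -- resonance at frequency ω only
    (∀ d : ℂ, d ≠ -1 →
      (∃ C δ : ℝ, 0 < δ ∧ ∀ e : ℂ, e ≠ -1 → ‖1 + e‖ < δ → ∀ u₀ v₀ u₁ v₁ : Potential,
        IsExpansion ⟨e, d, χperp, χpar⟩ E r₀ ℓ n u₀ v₀ u₁ v₁ →
          ∀ x : ℂ, r₀ < ‖x‖ → ‖v₁.out x‖ ≤ C / ‖1 + e‖ ^ 3) ∧
      (χperp ≠ 0 → d ≠ 0 →
        (fun e : ℂ => coeffRel ⟨e, d, χperp, χpar⟩ E r₀ ℓ n) =Θ[𝓝[≠] (-1)]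
          fun e : ℂ => ((1 + e) ^ 3)⁻¹)) ∧
    -- resonance at frequency 2ω only
    (∀ e : ℂ, e ≠ -1 →
      (∃ C δ : ℝ, 0 < δ ∧ ∀ d : ℂ, d ≠ -1 → ‖1 + d‖ < δ → ∀ u₀ v₀ u₁ v₁ : Potential,
        IsExpansion ⟨e, d, χperp, χpar⟩ E r₀ ℓ n u₀ v₀ u₁ v₁ →
          ∀ x : ℂ, r₀ < ‖x‖ → ‖v₁.out x‖ ≤ C / ‖1 + d‖ ^ 2) ∧
      (2 * ℓ < n → e ≠ 0 → χperp * e ≠ 2 * χpar →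
        (fun d : ℂ => coeffRel ⟨e, d, χperp, χpar⟩ E r₀ ℓ n) =Θ[𝓝[≠] (-1)]
          fun d : ℂ => ((1 + d) ^ 2)⁻¹)) ∧
    -- simultaneous resonance at both frequencies
    (∃ C δ : ℝ, 0 < δ ∧ ∀ e d : ℂ, e ≠ -1 → d ≠ -1 → ‖1 + e‖ < δ → ‖1 + d‖ < δ →
      ∀ u₀ v₀ u₁ v₁ : Potential,
        IsExpansion ⟨e, d, χperp, χpar⟩ E r₀ ℓ n u₀ v₀ u₁ v₁ → ∀ x : ℂ, r₀ < ‖x‖ →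
          (‖1 + d‖ ≤ ‖1 + e‖ → ‖v₁.out x‖ ≤ C / (‖1 + e‖ ^ 2 * ‖1 + d‖ ^ 2)) ∧
          (‖1 + e‖ ≤ ‖1 + d‖ → ‖v₁.out x‖ ≤ C / (‖1 + e‖ ^ 3 * ‖1 + d‖))) ∧
    (2 * ℓ < n → χperp + 2 * χpar ≠ 0 →
      (fun p : ℂ × ℂ => coeffRel ⟨p.1, p.2, χperp, χpar⟩ E r₀ ℓ n)
        =Θ[(𝓝[≠] (-1) ×ˢ 𝓝[≠] (-1)) ⊓ comap (fun p : ℂ × ℂ => (1 + p.2) / (1 + p.1)) (𝓝 0)]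
          fun p : ℂ × ℂ => ((1 + p.1) ^ 2 * (1 + p.2) ^ 2)⁻¹) ∧
    (χperp ≠ 0 →
      (fun p : ℂ × ℂ => coeffRel ⟨p.1, p.2, χperp, χpar⟩ E r₀ ℓ n)
        =Θ[(𝓝[≠] (-1) ×ˢ 𝓝[≠] (-1)) ⊓ comap (fun p : ℂ × ℂ => (1 + p.1) / (1 + p.2)) (𝓝 0)]
          fun p : ℂ × ℂ => ((1 + p.1) ^ 3 * (1 + p.2))⁻¹) := by
  refine ⟨?_, ?_, ?_, ?_, ?_, ?_, ?_, ?_⟩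
  · intro e d he hd
    exact ⟨_, _, _, _, isExpansion_explicit hr₀ hℓ hn hn2 he hd⟩
  · intro e d he hd u₀ v₀ u₁ v₁ h
    refine ⟨fun r θ hr => out_circleMap hr₀ hℓ hn hn2 he hd h θ hr, fun h1 => ?_, ?_⟩
    · exact isDipoleRadiation_of_isMultipoleRadiation_one
        (h1 ▸ isMultipoleRadiation_out hr₀ hℓ hn hn2 he hd h)
    · rintro m rfl
      exact ⟨isMultipoleRadiation_out hr₀ hℓ hn hn2 he hd h,
        isLittleO_out_iff hr₀ hℓ hn hn2 he hd h⟩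
  · intro hχ d hd0 hd
    exact finite_setOf_coeffRel_eq_zero hE hr₀ hℓ hn hχ hd0 hd
  · intro d hd
    have hb : 0 < ‖1 + d‖ := norm_pos_iff.2 (one_add_ne_zero_of_ne hd)
    refine ⟨?_, fun hχ hd0 => coeffRel_isTheta_omega hE hr₀ hℓ hn hd hχ hd0⟩
    -- The radius covers both the moving ε_ω within distance 1 of the resonance and the fixed
    -- ε_{2ω}.
    obtain ⟨C, hC0, hC⟩ := exists_norm_out_le (E := E) χperp χpar hr₀ hℓ hn hn2 (max 1 ‖1 + d‖)
    refine ⟨C * (1 / ‖1 + d‖ * (1 / ‖1 + d‖ + 1)), 1, one_pos, ?_⟩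
    intro e he he1 u₀ v₀ u₁ v₁ h x hx
    refine (hC e d he hd (he1.le.trans (le_max_left _ _)) (le_max_right _ _) u₀ v₀ u₁ v₁ h x
      hx).trans ?_
    rw [mul_div_assoc]
    exact mul_le_mul_of_nonneg_left (weight_le_of_left_le_one
      (norm_pos_iff.2 (one_add_ne_zero_of_ne he)) he1.le hb) hC0
  · intro e he
    have ha : 0 < ‖1 + e‖ := norm_pos_iff.2 (one_add_ne_zero_of_ne he)
    refine ⟨?_, fun h2 he0 hχ => coeffRel_isTheta_two_omega hE hr₀ hℓ h2 he he0 hχ⟩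
    obtain ⟨C, hC0, hC⟩ := exists_norm_out_le (E := E) χperp χpar hr₀ hℓ hn hn2 (max 1 ‖1 + e‖)
    refine ⟨C * (1 / ‖1 + e‖ ^ 2 * (1 + 1 / ‖1 + e‖)), 1, one_pos, ?_⟩
    intro d hd hd1 u₀ v₀ u₁ v₁ h x hx
    refine (hC e d he hd (le_max_right _ _) (hd1.le.trans (le_max_left _ _)) u₀ v₀ u₁ v₁ h x
      hx).trans ?_
    rw [mul_div_assoc]
    exact mul_le_mul_of_nonneg_left (weight_le_of_right_le_one ha
      (norm_pos_iff.2 (one_add_ne_zero_of_ne hd)) hd1.le) hC0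
  · obtain ⟨C, hC0, hC⟩ := exists_norm_out_le (E := E) χperp χpar hr₀ hℓ hn hn2 1
    refine ⟨C * 2, 1, one_pos, ?_⟩
    intro e d he hd he1 hd1 u₀ v₀ u₁ v₁ h x hx
    have ha : 0 < ‖1 + e‖ := norm_pos_iff.2 (one_add_ne_zero_of_ne he)
    have hb : 0 < ‖1 + d‖ := norm_pos_iff.2 (one_add_ne_zero_of_ne hd)
    have hout := hC e d he hd he1.le hd1.le u₀ v₀ u₁ v₁ h x hx
    refine ⟨fun hba => hout.trans ?_, fun hab => hout.trans ?_⟩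
    · rw [mul_div_assoc]
      exact mul_le_mul_of_nonneg_left (weight_le_of_right_le_left hb hba) hC0
    · rw [mul_div_assoc]
      exact mul_le_mul_of_nonneg_left (weight_le_of_left_le_right ha hab) hC0
  · intro h2 hχ
    exact coeffRel_isTheta_double hE hr₀ hℓ h2 hχ
  · intro hχ
    exact coeffRel_isTheta_triple hE hr₀ hℓ hn hχ
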